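/- Let $a,b>0$. Consider the CDK system $$\dot x=\frac{xy}{x^2+y^2}-ax,\qquad \dot y=\frac{y^2}{x^2+y^2}-by+b-1 \tag{1}$$ on the punctured plane $\Omega=\mathbb R^2\setminus\{0\}$, and the polynomial system $$\dot x=xy-a(x^3+xy^2),\qquad \dot y=y^2-(by-b+1)(x^2+y^2) \tag{2}$$ on $\mathbb R^2$. Orbits are the images of maximal solutions (defined on a possibly bounded open interval), and the $\omega$-limit set of a maximal solution is the set of its limit points in $\mathbb R^2$ as time tends to the right end of its maximal interval. Periodic orbits are understood to be nonstationary. A chaotic set of a system is a nonempty compact set $\Lambda$ contained in the domain of the system which is invariant (through each point of $\Lambda$ there is a solution that exists for all times and stays in $\Lambda$) and on which the flow has sensitive dependence on initial conditions (there is $\varepsilon>0$ such that every neighbourhood in $\Lambda$ of every $x\in\Lambda$ contains a point $y$ whose trajectory is at some time $t>0$ farther than $\varepsilon$ from that of $x$), is topologically transitive, and has dense periodic points (stationary points included). 1. The right-hand side of (2) is polynomial, hence $C^1$ on all of $\mathbb R^2$; the origin is a stationary point of (2); and the orbits of (1) are exactly the orbits of (2) other than $\{0\}$. More precisely, every maximal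 solution of (1) is a strictly increasing reparametrisation of a maximal solution of (2), and for every maximal solution of (2) with orbit different from $\{0\}$ there is a maximal solution of (1) that is a strictly increasing reparametrisation of it. 2. If a forward trajectory of a maximal solution of (2) is bounded, then its $\omega$-limit set contains a stationary point of (2) or is a periodic orbit of (2). If a forward trajectory of a maximal solution of (1) is bounded, then its $\omega$-limit set contains the origin or a stationary point of (1), or it is a periodic orbit of (1). 3. Neither (1) on $\Omega$ nor (2) on $\mathbb R^2$ has a chaotic set. 4. If $b<1$, then (2) has infinitely many orbits that are homoclinic to the origin. Every orbit of (2) homoclinic to the origin is bounded and is an orbit of (1). Every maximal solution of (1) with such an orbit has $\omega$-limit set $\{0\}$, and none of its forward trajectories is contained in a compact subset of $\Omega$ (so the hypothesis of the Poincaré–Bendixson theorem on $\Omega$ fails for it). -/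

import Mathlib

open Set Filter Topology

/-- The right-hand side of the CDK system
`x' = xy/(x²+y²) - a x`, `y' = y²/(x²+y²) - b y + b - 1`.
It is only ever used on the punctured plane `{0}ᶜ`. -/
noncomputable def cdkField (a b : ℝ) (p : ℝ × ℝ) : ℝ × ℝ :=
  (p.1 * p.2 / (p.1 ^ 2 + p.2 ^ 2) - a * p.1,
   p.2 ^ 2 / (p.1 ^ 2 + p.2 ^ 2) - b * p.2 + b - 1)

/-- The right-hand side of the polynomial system
`x' = xy - a(x³+xy²)`, `y' = y² - (by-b+1)(x²+y²)` on the whole plane. -/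
def polyField (a b : ℝ) (p : ℝ × ℝ) : ℝ × ℝ :=
  (p.1 * p.2 - a * (p.1 ^ 3 + p.1 * p.2 ^ 2),
   p.2 ^ 2 - (b * p.2 - b + 1) * (p.1 ^ 2 + p.2 ^ 2))

section Dynamics

variable {E : Type*} [NormedAddCommGroup E] [NormedSpace ℝ E]

/-- `γ`, restricted to the nonempty open interval `I`, is a maximal (inextensible) solution in `Ω`
of the autonomous system `x' = v x`. The values of `γ` outside `I` are irrelevant. -/
structure IsMaximalSolution (v : E → E) (Ω : Set E) (γ : ℝ → E) (I : Set ℝ) : Prop where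
  isOpen : IsOpen I
  ordConnected : I.OrdConnected
  nonempty : I.Nonempty
  mapsTo : MapsTo γ I Ω
  isIntegralCurveOn : IsIntegralCurveOn γ (fun _ => v) I
  maximal : ∀ (δ : ℝ → E) (J : Set ℝ), IsOpen J → J.OrdConnected → I ⊆ J → MapsTo δ J Ω →
    IsIntegralCurveOn δ (fun _ => v) J → EqOn δ γ I → J ⊆ I

/-- `O` is an orbit (trajectory) in `Ω`: the image of a maximal solution. -/
def IsOrbit (v : E → E) (Ω O : Set E) : Prop :=
  ∃ γ I, IsMaximalSolution v Ω γ I ∧ O = γ '' I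

/-- The curve `γ` on `I` is an orientation preserving reparametrisation of the curve `δ` on `J`. -/
def IsReparametrisation (γ : ℝ → E) (I : Set ℝ) (δ : ℝ → E) (J : Set ℝ) : Prop :=
  ∃ σ : ℝ → ℝ, StrictMonoOn σ I ∧ σ '' I = J ∧ EqOn γ (δ ∘ σ) I

/-- The part of the curve `γ` on `I` from time `t₀` on. -/
def forwardTrajectory (γ : ℝ → E) (I : Set ℝ) (t₀ : ℝ) : Set E :=
  γ '' (I ∩ Ici t₀)

/-- The `ω`-limit set of the curve `γ` on the open interval `I`: all limits of `γ (tₙ)` in the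
ambient space with `tₙ` tending to the (finite or infinite) right end of `I`. -/
def omegaLimitSet (γ : ℝ → E) (I : Set ℝ) : Set E :=
  ⋂ t₀ ∈ I, closure (forwardTrajectory γ I t₀)

/-- `S` is a (nonstationary) periodic orbit of `v` in `Ω`. -/
def IsPeriodicOrbit (v : E → E) (Ω S : Set E) : Prop :=
  ∃ (δ : ℝ → E) (T : ℝ), 0 < T ∧ IsIntegralCurve δ (fun _ => v) ∧ (∀ t, δ (t + T) = δ t) ∧
    (∀ t, v (δ t) ≠ 0) ∧ S = range δ ∧ S ⊆ Ω

/-- `O` is a homoclinic orbit of `v` at the stationary point `p`. -/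
def IsHomoclinicOrbit (v : E → E) (p : E) (O : Set E) : Prop :=
  v p = 0 ∧ ∃ δ : ℝ → E, IsIntegralCurve δ (fun _ => v) ∧ O = range δ ∧ p ∉ O ∧
    Tendsto δ atTop (𝓝 p) ∧ Tendsto δ atBot (𝓝 p)

/-- Sensitive dependence on initial conditions everywhere on the phase space. -/
def SensitiveDependence {X : Type*} [MetricSpace X] (φ : Flow ℝ X) : Prop :=
  ∃ ε > 0, ∀ x, ∀ U ∈ 𝓝 x, ∃ y ∈ U, ∃ t > 0, ε < dist (φ t x) (φ t y)

/-- Topological transitivity of a flow. -/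
def TopologicallyTransitive {X : Type*} [TopologicalSpace X] (φ : Flow ℝ X) : Prop :=
  ∀ U V : Set X, IsOpen U → IsOpen V → U.Nonempty → V.Nonempty → ∃ t, (φ t '' U ∩ V).Nonempty

/-- `Λ ⊆ Ω` is a chaotic set of `x' = v x`: nonempty, compact and invariant, that is, through each
of its points there passes a solution that exists for all times and stays in `Λ`, and the resulting
flow on `Λ` has sensitive dependence on initial conditions, is topologically transitive, and has
dense periodic points (stationary points count as periodic). For a `C¹` vector field
the flow `φ` on `Λ` is uniquely determined, and its continuity and group law are automatic. -/
def IsChaoticSet (v : E → E) (Ω Λ : Set E) : Prop :=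
  Λ.Nonempty ∧ IsCompact Λ ∧ Λ ⊆ Ω ∧
    ∃ φ : Flow ℝ Λ, (∀ x : Λ, IsIntegralCurve (fun t => (φ t x : E)) (fun _ => v)) ∧
      SensitiveDependence φ ∧ TopologicallyTransitive φ ∧
      Dense {x : Λ | ∃ T > 0, φ T x = x}

end Dynamics

/-! Off the origin the polynomial field is `sqNorm` times the CDK field, so the two systems have the
same oriented curves there. By uniqueness no other solution reaches the origin; a change of clock
therefore matches maximal solutions (`exists_maximal_reparametrisation`,
`isMaximalSolution_compl_singleton_iff`).

The core is `exists_stationary_of_invariant`: every nonempty compact invariant set contains a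
stationary point of the polynomial field. If the set meets the invariant line x = 0, its highest
point there is stationary. Otherwise y > 0 on it, and `lyapunov` is nondecreasing along
trajectories, with derivative a positive multiple of ((a-b)y-(1-b))²; at a minimiser the backward
trajectory must lie on the zero line of this square, which forces it to be stationary (a = b = 1 is
treated separately). Applied to limit sets, this always gives the stationary alternative of
Poincaré–Bendixson. Applied to periodic orbits, it shows that they are all stationary, so density of
periodic points would make the flow on a chaotic set the identity, contradicting sensitivity.

For b < 1 the trajectory through (c, 0) with small c > 0 stays below the x-axis afterwards and above
it before. The Euclidean norm r decreases forwards and r - y/2 decreases backwards, which traps the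
trajectory near the isolated stationary point 0 and makes it converge there in both directions
(`exists_homoclinic`). -/

namespace CDK

/-! ### Uniqueness, global existence and limit sets for C¹ vector fields -/

section ODE

variable {E : Type*} [NormedAddCommGroup E] [NormedSpace ℝ E]

/-- A vanishing solution of a linear differential inequality vanishes identically,
in both time directions. -/
lemma eq_zero_of_norm_deriv_le {f f' : ℝ → E} {M s t : ℝ}
    (hf : ∀ τ ∈ uIcc s t, HasDerivAt f (f' τ) τ) (hM : ∀ τ ∈ uIcc s t, ‖f' τ‖ ≤ M * ‖f τ‖)
    (hs : f s = 0) : f t = 0 := by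
  rcases le_total s t with h | h
  · rw [uIcc_of_le h] at hf hM
    exact eq_zero_of_abs_deriv_le_mul_abs_self_of_eq_zero_right
      (fun τ hτ => (hf τ hτ).continuousAt.continuousWithinAt)
      (fun τ hτ => (hf τ (Ico_subset_Icc_self hτ)).hasDerivWithinAt) hs
      (fun τ hτ => hM τ (Ico_subset_Icc_self hτ)) t ⟨h, le_rfl⟩
  · rw [uIcc_of_ge h] at hf hM
    have hmem : ∀ τ ∈ Icc (-s) (-t), -τ ∈ Icc t s := fun τ hτ =>
      ⟨by linarith [hτ.2], by linarith [hτ.1]⟩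
    have hd : ∀ τ ∈ Icc (-s) (-t), HasDerivAt (fun u => f (-u)) (-f' (-τ)) τ := fun τ hτ => by
      simpa [Function.comp_def] using (hf (-τ) (hmem τ hτ)).scomp τ (hasDerivAt_neg τ)
    have := eq_zero_of_abs_deriv_le_mul_abs_self_of_eq_zero_right (K := M)
      (fun τ hτ => (hd τ hτ).continuousAt.continuousWithinAt)
      (fun τ hτ => (hd τ (Ico_subset_Icc_self hτ)).hasDerivWithinAt) (by simpa using hs)
      (fun τ hτ => by simpa using hM (-τ) (hmem τ (Ico_subset_Icc_self hτ))) (-t)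
      ⟨by linarith, le_rfl⟩
    simpa using this

/-- Grönwall's estimate for two solutions of a Lipschitz equation, in both time directions. -/
lemma dist_le_of_lipschitzWith {F : E → E} {K : NNReal} (hF : LipschitzWith K F) {f g : ℝ → E}
    {s t : ℝ} (hf : ∀ τ ∈ uIcc s t, HasDerivAt f (F (f τ)) τ)
    (hg : ∀ τ ∈ uIcc s t, HasDerivAt g (F (g τ)) τ) :
    dist (f t) (g t) ≤ dist (f s) (g s) * Real.exp (K * |t - s|) := by
  rcases le_total s t with h | h
  · rw [uIcc_of_le h] at hf hg
    rw [abs_of_nonneg (sub_nonneg.2 h)]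
    exact dist_le_of_trajectories_ODE (v := fun _ => F) (fun _ => hF)
      (fun τ hτ => (hf τ hτ).continuousAt.continuousWithinAt)
      (fun τ hτ => (hf τ (Ico_subset_Icc_self hτ)).hasDerivWithinAt)
      (fun τ hτ => (hg τ hτ).continuousAt.continuousWithinAt)
      (fun τ hτ => (hg τ (Ico_subset_Icc_self hτ)).hasDerivWithinAt) le_rfl t ⟨h, le_rfl⟩
  · rw [uIcc_of_ge h] at hf hg
    rw [abs_of_nonpos (sub_nonpos.2 h)]
    have hmem : ∀ τ ∈ Icc (-s) (-t), -τ ∈ Icc t s := fun τ hτ =>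
      ⟨by linarith [hτ.2], by linarith [hτ.1]⟩
    have hd : ∀ {k : ℝ → E}, (∀ τ ∈ Icc t s, HasDerivAt k (F (k τ)) τ) →
        ∀ τ ∈ Icc (-s) (-t), HasDerivAt (fun u => k (-u)) (-F (k (-τ))) τ := fun hk τ hτ => by
      simpa [Function.comp_def] using (hk (-τ) (hmem τ hτ)).scomp τ (hasDerivAt_neg τ)
    have hF' : LipschitzWith K (fun p => -F p) := hF.neg
    have := dist_le_of_trajectories_ODE (v := fun _ p => -F p) (fun _ => hF')
      (fun τ hτ => (hd hf τ hτ).continuousAt.continuousWithinAt)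
      (fun τ hτ => (hd hf τ (Ico_subset_Icc_self hτ)).hasDerivWithinAt)
      (fun τ hτ => (hd hg τ hτ).continuousAt.continuousWithinAt)
      (fun τ hτ => (hd hg τ (Ico_subset_Icc_self hτ)).hasDerivWithinAt) le_rfl (-t)
      ⟨by linarith, le_rfl⟩
    simpa [add_comm, sub_eq_add_neg] using this

/-- A bounded Lipschitz vector field is complete. -/
lemma exists_isIntegralCurve_of_lipschitzWith [CompleteSpace E] {F : E → E} {K : NNReal}
    (hF : LipschitzWith K F) {C : ℝ} (hC : ∀ p, ‖F p‖ ≤ C) (x : E) :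
    ∃ γ : ℝ → E, γ 0 = x ∧ IsIntegralCurve γ (fun _ => F) := by
  have hC0 : 0 ≤ C := (norm_nonneg _).trans (hC x)
  have key : ∀ n : ℝ, 0 < n → ∃ α : ℝ → E, α 0 = x ∧
      ∀ t ∈ Ioo (-n) n, HasDerivAt α (F (α t)) t := by
    intro n hn
    have hm : C * max (n - 0) (0 - -n) ≤ C * n - 0 := by simp
    -- A ball of radius C * n cannot be left within time n at speed at most C, so Picard–Lindelöf
    -- covers all of [-n, n].
    have hpl : IsPicardLindelof (fun _ => F) (tmin := -n) (tmax := n)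
        ⟨0, by constructor <;> linarith⟩ x (⟨C, hC0⟩ * ⟨n, hn.le⟩) 0 ⟨C, hC0⟩ K :=
      IsPicardLindelof.of_time_independent (fun p _ => hC p) hF.lipschitzOnWith
        hm
    obtain ⟨α, h0, hα⟩ := hpl.exists_eq_forall_mem_Icc_hasDerivWithinAt₀
    exact ⟨α, h0, fun t ht => (hα t (Ioo_subset_Icc_self ht)).hasDerivAt (Icc_mem_nhds ht.1 ht.2)⟩
  choose! α h0 hα using key
  have hagree : ∀ m n t : ℝ, |t| < m → |t| < n → α m t = α n t := by
    intro m n t hm hn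
    have hsub : ∀ k : ℝ, |t| < k → ∀ τ ∈ uIcc 0 t, HasDerivAt (α k) (F (α k τ)) τ := by
      intro k hk τ hτ
      refine hα k ((abs_nonneg t).trans_lt hk) τ (abs_lt.1 (lt_of_le_of_lt ?_ hk))
      simpa using abs_sub_left_of_mem_uIcc hτ
    have := dist_le_of_lipschitzWith hF (hsub m hm) (hsub n hn)
    rw [h0 m ((abs_nonneg t).trans_lt hm), h0 n ((abs_nonneg t).trans_lt hn)] at this
    exact dist_le_zero.1 (by simpa using this)
  refine ⟨fun t => α (|t| + 1) t, h0 _ (by positivity), fun t => ?_⟩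
  refine (hα (|t| + 1) (by positivity) t (abs_lt.1 (lt_add_one _))).congr_of_eventuallyEq ?_
  filter_upwards [(continuous_abs.tendsto t).eventually (gt_mem_nhds (lt_add_one |t|))] with u hu
  exact hagree _ _ u (lt_add_one _) hu

variable [FiniteDimensional ℝ E]

/-- Cutting off a `C¹` vector field outside a ball. -/
lemma exists_cutoff {v : E → E} (hv : ContDiff ℝ 1 v) {r R : ℝ} (hr : 0 < r) (hrR : r < R) :
    ∃ f : E → ℝ, (∀ p, 0 ≤ f p) ∧ (∀ p, ‖p‖ ≤ r → f p = 1) ∧ (∀ p, R ≤ ‖p‖ → f p = 0) ∧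
      ∃ (K : NNReal) (C : ℝ), LipschitzWith K (fun p => f p • v p) ∧ ∀ p, ‖f p • v p‖ ≤ C := by
  let f : ContDiffBump (0 : E) := ⟨r, R, hr, hrR⟩
  have hsm : ContDiff ℝ 1 (fun p => f p • v p) := f.contDiff.smul hv
  have hcs : HasCompactSupport (fun p => f p • v p) := f.hasCompactSupport.smul_right
  obtain ⟨K, hK⟩ := hsm.lipschitzWith_of_hasCompactSupport hcs one_ne_zero
  obtain ⟨C, hC⟩ := hcs.exists_bound_of_continuous hsm.continuous
  exact ⟨f, f.nonneg', fun p hp => f.one_of_mem_closedBall (by simpa using hp),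
    fun p hp => f.zero_of_le_dist (by simpa using hp), K, C, hK, hC⟩

/-- Lets the global Lipschitz theory (Grönwall, completeness) act on solutions known to stay in a
ball. -/
lemma exists_lipschitz_extension {v : E → E} (hv : ContDiff ℝ 1 v) (R : ℝ) :
    ∃ (F : E → E) (K : NNReal) (C : ℝ), LipschitzWith K F ∧ (∀ p, ‖F p‖ ≤ C) ∧
      ∀ p, ‖p‖ ≤ R → F p = v p := by
  obtain ⟨f, -, h1, -, K, C, hK, hC⟩ := exists_cutoff hv (r := |R| + 1) (by positivity)
    (lt_add_one _)
  refine ⟨_, K, C, hK, hC, fun p hp => ?_⟩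
  simp [h1 p (hp.trans ((le_abs_self R).trans (lt_add_one _).le))]

/-- Uniqueness of solutions on intervals. -/
lemma eqOn_of_contDiff {v : E → E} (hv : ContDiff ℝ 1 v) {I : Set ℝ} (hI : I.OrdConnected)
    {f g : ℝ → E} (hf : ∀ t ∈ I, HasDerivAt f (v (f t)) t)
    (hg : ∀ t ∈ I, HasDerivAt g (v (g t)) t) {s : ℝ} (hs : s ∈ I) (h : f s = g s) :
    EqOn f g I := by
  intro t ht
  have hsub : uIcc s t ⊆ I := hI.uIcc_subset hs ht
  have hbd : ∀ {k : ℝ → E}, (∀ t ∈ I, HasDerivAt k (v (k t)) t) →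
      ∃ R, ∀ τ ∈ uIcc s t, ‖k τ‖ ≤ R := fun hk =>
    isCompact_uIcc.exists_bound_of_continuousOn
      fun τ hτ => (hk τ (hsub hτ)).continuousAt.continuousWithinAt
  obtain ⟨R₁, h₁⟩ := hbd hf
  obtain ⟨R₂, h₂⟩ := hbd hg
  obtain ⟨F, K, C, hK, -, hF⟩ := exists_lipschitz_extension hv (max R₁ R₂)
  have := dist_le_of_lipschitzWith hK (f := f) (g := g) (s := s) (t := t)
    (fun τ hτ => by rw [hF _ ((h₁ τ hτ).trans (le_max_left _ _))]; exact hf τ (hsub hτ))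
    (fun τ hτ => by rw [hF _ ((h₂ τ hτ).trans (le_max_right _ _))]; exact hg τ (hsub hτ))
  rw [h, dist_self, zero_mul] at this
  exact dist_le_zero.1 this

/-- A solution that reaches a stationary point is stationary. -/
lemma eq_of_stationary {v : E → E} (hv : ContDiff ℝ 1 v) {I : Set ℝ} (hI : I.OrdConnected)
    {f : ℝ → E} (hf : ∀ t ∈ I, HasDerivAt f (v (f t)) t) {s : ℝ} (hs : s ∈ I)
    (h : v (f s) = 0) : ∀ t ∈ I, f t = f s := fun _ ht =>
  eqOn_of_contDiff hv hI hf (g := fun _ => f s) (fun t _ => by rw [h]; exact hasDerivAt_const t _)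
    hs rfl ht

/-- `K` is invariant: through each of its points there is a global solution staying in `K`. -/
def IsInvariantSet (v : E → E) (K : Set E) : Prop :=
  ∀ q ∈ K, ∃ γ : ℝ → E, γ 0 = q ∧ ∀ t, γ t ∈ K ∧ HasDerivAt γ (v (γ t)) t

/-- The limit set of a bounded solution is nonempty, compact and invariant. -/
lemma clusterSet_invariant {v : E → E} (hv : ContDiff ℝ 1 v) {γ : ℝ → E} {t₀ R : ℝ}
    (hγ : ∀ t > t₀, HasDerivAt γ (v (γ t)) t) (hR : ∀ t > t₀, ‖γ t‖ ≤ R) :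
    {q | MapClusterPt q atTop γ}.Nonempty ∧ IsCompact {q | MapClusterPt q atTop γ} ∧
      IsInvariantSet v {q | MapClusterPt q atTop γ} := by
  have hmem : ∀ᶠ t in atTop, γ t ∈ Metric.closedBall (0 : E) R := by
    filter_upwards [eventually_gt_atTop t₀] with t ht
    simpa using hR t ht
  have hsub : {q | MapClusterPt q atTop γ} ⊆ Metric.closedBall (0 : E) R := fun q hq =>
    Metric.isClosed_closedBall.mem_of_mapClusterPt hq hmem
  refine ⟨?_, ?_, ?_⟩
  · obtain ⟨q, -, hq⟩ := (isCompact_closedBall (0 : E) R).exists_mapClusterPt_of_frequently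
      hmem.frequently
    exact ⟨q, hq⟩
  · exact (isCompact_closedBall (0 : E) R).of_isClosed_subset isClosed_setOfPred_clusterPt hsub
  · intro q hq
    obtain ⟨F, K, C, hK, hC, hF⟩ := exists_lipschitz_extension hv R
    obtain ⟨δ, h0, hδ⟩ := exists_isIntegralCurve_of_lipschitzWith hK hC q
    have hδL : ∀ t, MapClusterPt (δ t) atTop γ := by
      intro t
      rw [Metric.nhds_basis_ball.mapClusterPt_iff_frequently]
      intro ε hε
      -- By Grönwall, if γ s is this close to q, then γ (s + t) is ε-close to δ t; s is also taken
      -- so large that the whole time segment lies beyond t₀.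
      have hfr := (Metric.nhds_basis_ball.mapClusterPt_iff_frequently.1 hq)
        (ε / Real.exp (K * |t|)) (by positivity)
      have hev : ∀ᶠ s in atTop, t₀ + |t| < s := eventually_gt_atTop _
      rw [frequently_atTop]
      intro A
      obtain ⟨s, hsA, hs, hst⟩ := frequently_atTop.1 (hfr.and_eventually hev) (A - t)
      refine ⟨s + t, by linarith, ?_⟩
      have := dist_le_of_lipschitzWith hK (f := fun u => γ (s + u)) (g := δ) (s := 0) (t := t)
        (fun τ hτ => ?_) (fun τ _ => hδ τ)
      · simp only [sub_zero, add_zero, h0] at this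
        refine Metric.mem_ball.2 (this.trans_lt ?_)
        have := Metric.mem_ball.1 hs
        rwa [lt_div_iff₀ (Real.exp_pos _)] at this
      · have hτ' : |τ| ≤ |t| := by simpa using abs_sub_left_of_mem_uIcc hτ
        have hlt : t₀ < s + τ := by linarith [neg_abs_le τ]
        rw [hF _ (hR _ hlt)]
        exact (hγ _ hlt).comp_const_add s τ
    refine ⟨δ, h0, fun t => ⟨hδL t, ?_⟩⟩
    rw [← hF _ (by simpa using hsub (hδL t))]
    exact hδ t

end ODE

/-! ### Compact invariant sets contain stationary points -/

section Invariant

lemma contDiff_polyField (a b : ℝ) : ContDiff ℝ 1 (polyField a b) := by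
  unfold polyField
  fun_prop

lemma polyField_zero (a b : ℝ) : polyField a b 0 = 0 := by
  simp [polyField]

/-- Squared Euclidean norm. -/
def sqNorm (p : ℝ × ℝ) : ℝ := p.1 ^ 2 + p.2 ^ 2

lemma continuous_sqNorm : Continuous sqNorm := by unfold sqNorm; fun_prop

lemma sqNorm_pos {p : ℝ × ℝ} (hp : p ≠ 0) : 0 < sqNorm p := by
  rcases p with ⟨x, y⟩
  by_contra! h
  simp only [sqNorm] at h
  exact hp (Prod.ext (by nlinarith [sq_nonneg x, sq_nonneg y] : x = 0)
    (by nlinarith [sq_nonneg x, sq_nonneg y] : y = 0))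

lemma polyField_eq_smul (a b : ℝ) {p : ℝ × ℝ} (hp : p ≠ 0) :
    polyField a b p = sqNorm p • cdkField a b p := by
  have h := (sqNorm_pos hp).ne'
  unfold sqNorm at *
  ext
  · simp only [polyField, cdkField, Prod.smul_mk, smul_eq_mul]; field_simp
  · simp only [polyField, cdkField, Prod.smul_mk, smul_eq_mul]; field_simp; ring

lemma cdkField_eq_smul (a b : ℝ) {p : ℝ × ℝ} (hp : p ≠ 0) :
    cdkField a b p = (sqNorm p)⁻¹ • polyField a b p := by
  rw [polyField_eq_smul a b hp, smul_smul, inv_mul_cancel₀ (sqNorm_pos hp).ne', one_smul]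

/-- The Lyapunov function of the system on the set where `x ≠ 0` and `y > 0`. -/
noncomputable def lyapunov (a b : ℝ) (p : ℝ × ℝ) : ℝ :=
  -(b * (1 - b)) * Real.log p.2 - b * (a - 1) * Real.log p.1
    + (a - b) / 2 * Real.log (sqNorm p) - (a - b) ^ 2 * p.2

variable {a b c : ℝ} {γ : ℝ → ℝ × ℝ} {t : ℝ}

/-- The free factor c lets one computation serve both systems and the cut-off field. -/
lemma hasDerivAt_fst (h : HasDerivAt γ (c • polyField a b (γ t)) t) :
    HasDerivAt (fun s => (γ s).1) (c * ((γ t).1 * ((γ t).2 - a * sqNorm (γ t)))) t := by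
  have := (ContinuousLinearMap.fst ℝ ℝ ℝ).hasFDerivAt.comp_hasDerivAt t h
  refine this.congr_deriv ?_
  simp only [polyField, sqNorm, ContinuousLinearMap.coe_fst', Prod.smul_mk, smul_eq_mul]
  ring

lemma hasDerivAt_snd (h : HasDerivAt γ (c • polyField a b (γ t)) t) :
    HasDerivAt (fun s => (γ s).2)
      (c * ((γ t).2 ^ 2 - (b * (γ t).2 - b + 1) * sqNorm (γ t))) t := by
  have := (ContinuousLinearMap.snd ℝ ℝ ℝ).hasFDerivAt.comp_hasDerivAt t h
  refine this.congr_deriv ?_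
  simp only [polyField, sqNorm, ContinuousLinearMap.coe_snd', Prod.smul_mk, smul_eq_mul]

lemma hasDerivAt_sqNorm (h : HasDerivAt γ (c • polyField a b (γ t)) t) :
    HasDerivAt (fun s => sqNorm (γ s))
      (c * (2 * sqNorm (γ t) * (b * (γ t).2 - a * (γ t).1 ^ 2 - b * (γ t).2 ^ 2))) t := by
  have := ((hasDerivAt_fst h).pow 2).add ((hasDerivAt_snd h).pow 2)
  refine this.congr_deriv ?_
  simp only [sqNorm]
  ring

/-- The coefficients of `lyapunov` are chosen so that the derivative completes to a square.
Stationary points with x ≠ 0 lie on its zero line. Since `Real.log` is log |x|, both signs of x are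
covered. -/
lemma hasDerivAt_lyapunov (h : HasDerivAt γ (c • polyField a b (γ t)) t)
    (hx : (γ t).1 ≠ 0) (hy : 0 < (γ t).2) :
    HasDerivAt (fun s => lyapunov a b (γ s))
      (c * (sqNorm (γ t) * (b * ((a - b) * (γ t).2 - (1 - b)) ^ 2 / (γ t).2))) t := by
  have hne : γ t ≠ 0 := fun h0 => hx (by rw [h0]; rfl)
  have hr := (sqNorm_pos hne).ne'
  have := (((((hasDerivAt_snd h).log hy.ne').const_mul (-(b * (1 - b)))).sub
    (((hasDerivAt_fst h).log hx).const_mul (b * (a - 1)))).add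
    (((hasDerivAt_sqNorm h).log hr).const_mul ((a - b) / 2))).sub
    ((hasDerivAt_snd h).const_mul ((a - b) ^ 2))
  refine this.congr_deriv ?_
  have hy' := hy.ne'
  have : sqNorm (γ t) = (γ t).1 ^ 2 + (γ t).2 ^ 2 := rfl
  generalize sqNorm (γ t) = r at *
  field_simp
  rw [this]
  ring

lemma eventually_lt_of_deriv_neg {f : ℝ → ℝ} {f' s : ℝ} (hf : HasDerivAt f f' s) (h : f' < 0) :
    ∀ᶠ t in 𝓝[>] s, f t < f s := by
  have := (hasDerivWithinAt_iff_tendsto_slope' (s := Ioi s) (by simp)).1 hf.hasDerivWithinAt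
  filter_upwards [this.eventually (gt_mem_nhds h), self_mem_nhdsWithin] with t ht hst
  rw [slope_def_field, div_lt_iff₀ (sub_pos.2 hst)] at ht
  linarith

lemma abs_le_of_norm_le {p : ℝ × ℝ} {R : ℝ} (h : ‖p‖ ≤ R) : |p.1| ≤ R ∧ |p.2| ≤ R := by
  simpa [Prod.norm_def] using h

variable {v : ℝ × ℝ → ℝ × ℝ} {K : Set (ℝ × ℝ)} {k : ℝ × ℝ → ℝ} {M : ℝ}

/-- On a compact set, a coordinate satisfying a linear equation along a trajectory
stays zero once it is zero. -/
lemma eq_zero_of_deriv_eq_mul (hK : IsCompact K) (hkM : ∀ p ∈ K, 0 < k p ∧ k p ≤ M)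
    {f : ℝ → ℝ} {g : ℝ × ℝ → ℝ} (hg : Continuous g)
    (hγ : ∀ t, γ t ∈ K) (hf : ∀ t, HasDerivAt f (k (γ t) * (f t * g (γ t))) t) (h0 : f 0 = 0)
    (t : ℝ) : f t = 0 := by
  obtain ⟨C, hC⟩ := hK.exists_bound_of_continuousOn hg.continuousOn
  refine eq_zero_of_norm_deriv_le (M := M * C) (fun τ _ => hf τ) (fun τ _ => ?_) h0
  obtain ⟨h1, h2⟩ := hkM _ (hγ τ)
  have h3 := hC _ (hγ τ)
  calc ‖k (γ τ) * (f τ * g (γ τ))‖ = k (γ τ) * ‖g (γ τ)‖ * ‖f τ‖ := by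
        rw [norm_mul, norm_mul, Real.norm_of_nonneg h1.le]; ring
    _ ≤ M * C * ‖f τ‖ := by
        have : 0 ≤ M := h1.le.trans h2
        gcongr

/-- A nonempty compact invariant set that meets the `y`-axis contains a stationary point. -/
lemma exists_stationary_of_meets_axis (hK : IsCompact K)
    (hkM : ∀ p ∈ K, 0 < k p ∧ k p ≤ M)
    (hv : ∀ p ∈ K, v p = k p • polyField a b p) (hinv : IsInvariantSet v K)
    (hx : ∃ p ∈ K, p.1 = 0) : ∃ q ∈ K, polyField a b q = 0 := by
  -- The axis is invariant, so y has vanishing derivative at its maximum on this slice; on the axis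
  -- that already means stationary.
  have hK' : IsCompact (K ∩ {p | p.1 = 0}) :=
    hK.inter_right (isClosed_eq continuous_fst continuous_const)
  obtain ⟨q, ⟨hqK, hq0⟩, hmax⟩ := hK'.exists_isMaxOn hx (continuous_snd.continuousOn)
  obtain ⟨γ, rfl, hγ⟩ := hinv q hqK
  have hd : ∀ t, HasDerivAt γ (k (γ t) • polyField a b (γ t)) t := fun t => by
    rw [← hv _ (hγ t).1]; exact (hγ t).2
  have hx0 : ∀ t, (γ t).1 = 0 := fun t =>
    eq_zero_of_deriv_eq_mul hK hkM (g := fun p => p.2 - a * sqNorm p)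
      (by have := continuous_sqNorm; fun_prop)
      (fun t => (hγ t).1) (fun t => hasDerivAt_fst (hd t)) hq0 t
  have hloc : IsLocalMax (fun t => (γ t).2) 0 :=
    Eventually.of_forall fun t => hmax ⟨(hγ t).1, hx0 t⟩
  have := hloc.hasDerivAt_eq_zero (hasDerivAt_snd (hd 0))
  have h1 := (mul_eq_zero.1 this).resolve_left (hkM _ hqK).1.ne'
  refine ⟨γ 0, hqK, ?_⟩
  ext
  · simp [polyField, hx0 0]
  · simpa [polyField, sqNorm] using h1

/-- In a compact invariant set off the `y`-axis, the coordinate `y` is positive. -/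
lemma snd_pos_of_invariant (ha : 0 < a) (hb : 0 < b) (hK : IsCompact K)
    (hkM : ∀ p ∈ K, 0 < k p ∧ k p ≤ M)
    (hv : ∀ p ∈ K, v p = k p • polyField a b p) (hinv : IsInvariantSet v K)
    (hx : ∀ p ∈ K, p.1 ≠ 0) : ∀ p ∈ K, 0 < p.2 := by
  by_contra! hcon
  obtain ⟨p, hpK, hp⟩ := hcon
  have hr : ∀ p ∈ K, 0 < sqNorm p := fun p hp =>
    sqNorm_pos fun h => hx p hp (by rw [h]; rfl)
  -- If b > 1, then y' > 0 at a lowest point with y ≤ 0, contradicting minimality. If b ≤ 1,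
  -- trajectories starting in y ≤ 0 remain there for a short time while x² strictly decreases, so x²
  -- has no minimum on that part of K.
  rcases lt_or_ge 1 b with hb1 | hb1
  · obtain ⟨q, hqK, hmin⟩ := hK.exists_isMinOn ⟨p, hpK⟩ continuous_snd.continuousOn
    have hq : q.2 ≤ 0 := (hmin hpK).trans hp
    obtain ⟨γ, rfl, hγ⟩ := hinv q hqK
    have hloc : IsLocalMin (fun t => (γ t).2) 0 := Eventually.of_forall fun t => hmin (hγ t).1
    have hd := hasDerivAt_snd (by rw [← hv _ hqK]; exact (hγ 0).2)
    have := (mul_eq_zero.1 (hloc.hasDerivAt_eq_zero hd)).resolve_left (hkM _ hqK).1.ne'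
    nlinarith [mul_pos (sub_pos.2 hb1) (hr _ hqK), sq_nonneg (γ 0).2,
      mul_nonneg (mul_nonneg hb.le (neg_nonneg.2 hq)) (hr _ hqK).le]
  · have hK' : IsCompact (K ∩ {p | p.2 ≤ 0}) :=
      hK.inter_right (isClosed_le continuous_snd continuous_const)
    obtain ⟨q, ⟨hqK, hq⟩, hmin⟩ := hK'.exists_isMinOn ⟨p, hpK, hp⟩
      (f := fun p => p.1 ^ 2) (by fun_prop)
    obtain ⟨γ, rfl, hγ⟩ := hinv q hqK
    have hd : ∀ t, HasDerivAt γ (k (γ t) • polyField a b (γ t)) t := fun t => by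
      rw [← hv _ (hγ t).1]; exact (hγ t).2
    have hkq := (hkM _ hqK).1
    have hrq := hr _ hqK
    have hy : ∀ᶠ t in 𝓝[>] (0 : ℝ), (γ t).2 ≤ 0 := by
      rcases (show (γ 0).2 ≤ 0 from hq).lt_or_eq with h | h
      · have := (hasDerivAt_snd (hd 0)).continuousAt.eventually (gt_mem_nhds h)
        exact (this.filter_mono nhdsWithin_le_nhds).mono fun _ h => h.le
      · rcases hb1.lt_or_eq with hb1 | rfl
        · refine (eventually_lt_of_deriv_neg (hasDerivAt_snd (hd 0)) ?_).mono
            fun t ht => ht.le.trans h.le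
          rw [h]
          have := mul_pos hkq (mul_pos (sub_pos.2 hb1) hrq)
          nlinarith
        · refine Eventually.of_forall fun t => le_of_eq ?_
          refine eq_zero_of_deriv_eq_mul hK hkM (f := fun t => (γ t).2)
            (g := fun p => p.2 - sqNorm p)
            (by have := continuous_sqNorm; fun_prop) (fun t => (hγ t).1)
            (fun t => (hasDerivAt_snd (hd t)).congr_deriv (by ring)) h t
    have hlt := eventually_lt_of_deriv_neg ((hasDerivAt_fst (hd 0)).pow 2) (by
      have h1 : 0 < (γ 0).1 ^ 2 := by have := hx _ hqK; positivity
      have h2 := mul_pos hkq (mul_pos h1 (mul_pos ha hrq))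
      have h3 := mul_nonneg hkq.le (mul_nonneg h1.le (neg_nonneg.2 hq))
      simp only [Nat.cast_ofNat, Nat.add_one_sub_one, pow_one]
      nlinarith)
    obtain ⟨t, h1, h2⟩ := (hy.and hlt).exists
    exact absurd (hmin ⟨(hγ t).1, h1⟩) (not_le.2 h2)

/-- A nonempty compact invariant set contains a stationary point. -/
lemma exists_stationary_of_invariant (ha : 0 < a) (hb : 0 < b) (hK : IsCompact K)
    (hne : K.Nonempty) (hkM : ∀ p ∈ K, 0 < k p ∧ k p ≤ M)
    (hv : ∀ p ∈ K, v p = k p • polyField a b p) (hinv : IsInvariantSet v K) :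
    ∃ q ∈ K, polyField a b q = 0 := by
  by_cases hx : ∃ p ∈ K, p.1 = 0
  · exact exists_stationary_of_meets_axis hK hkM hv hinv hx
  push Not at hx
  have hy := snd_pos_of_invariant ha hb hK hkM hv hinv hx
  have hr : ∀ p ∈ K, 0 < sqNorm p := fun p hp =>
    sqNorm_pos fun h => hx p hp (by rw [h]; rfl)
  have hd : ∀ {γ : ℝ → ℝ × ℝ} {t}, γ t ∈ K → HasDerivAt γ (v (γ t)) t →
      HasDerivAt γ (k (γ t) • polyField a b (γ t)) t := fun h h' => by
    rw [← hv _ h]; exact h'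
  -- For a = b = 1 the square vanishes identically and `lyapunov` gives nothing; but then the field
  -- is (y - r)(x, y) with r = x² + y², and an extremum of x² forces y = r.
  by_cases hab : a = b ∧ b = 1
  · obtain ⟨q, hqK, hmin⟩ := hK.exists_isMinOn hne (f := fun p => p.1 ^ 2) (by fun_prop)
    obtain ⟨γ, rfl, hγ⟩ := hinv q hqK
    have hloc : IsLocalMin (fun t => (γ t).1 ^ 2) 0 :=
      Eventually.of_forall fun t => hmin (hγ t).1
    have := hloc.hasDerivAt_eq_zero ((hasDerivAt_fst (hd hqK (hγ 0).2)).pow 2)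
    have h1 : (γ 0).2 - a * sqNorm (γ 0) = 0 := by
      simpa [hx _ hqK, (hkM _ hqK).1.ne'] using this
    refine ⟨γ 0, hqK, ?_⟩
    obtain ⟨rfl, rfl⟩ := hab
    simp only [sqNorm] at h1
    ext
    · simp only [polyField, Prod.fst_zero]; linear_combination (γ 0).1 * h1
    · simp only [polyField, Prod.snd_zero]; linear_combination (γ 0).2 * h1
  · have hcont : ContinuousOn (lyapunov a b) K := by
      have h1 : ContinuousOn (fun p : ℝ × ℝ => Real.log p.2) K :=
        continuousOn_snd.log fun p hp => (hy p hp).ne'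
      have h2 : ContinuousOn (fun p : ℝ × ℝ => Real.log p.1) K :=
        continuousOn_fst.log fun p hp => hx p hp
      have h3 : ContinuousOn (fun p : ℝ × ℝ => Real.log (sqNorm p)) K :=
        continuous_sqNorm.continuousOn.log fun p hp => (hr p hp).ne'
      unfold lyapunov
      fun_prop
    obtain ⟨q, hqK, hmin⟩ := hK.exists_isMinOn hne hcont
    obtain ⟨γ, rfl, hγ⟩ := hinv q hqK
    have hL := fun t => hasDerivAt_lyapunov (hd (hγ t).1 (hγ t).2) (hx _ (hγ t).1) (hy _ (hγ t).1)
    have hmono : Monotone fun t => lyapunov a b (γ t) := by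
      refine monotone_of_deriv_nonneg (fun t => (hL t).differentiableAt) fun t => ?_
      rw [(hL t).deriv]
      have h1 := (hkM _ (hγ t).1).1
      have h2 := hr _ (hγ t).1
      have h3 := hy _ (hγ t).1
      positivity
    -- The past of a minimiser of a nondecreasing function stays at the minimum value.
    have hconst : ∀ t < 0, lyapunov a b (γ t) = lyapunov a b (γ 0) := fun t ht =>
      le_antisymm (hmono ht.le) (hmin (hγ t).1)
    have hline : ∀ t < 0, (a - b) * (γ t).2 - (1 - b) = 0 := by
      intro t ht
      have hev : (fun s => lyapunov a b (γ s)) =ᶠ[𝓝 t] fun _ => lyapunov a b (γ 0) := by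
        filter_upwards [gt_mem_nhds ht] with s hs using hconst s hs
      have := (hL t).unique ((hasDerivAt_const t _).congr_of_eventuallyEq hev)
      simpa [(hkM _ (hγ t).1).1.ne', (hr _ (hγ t).1).ne', hb.ne', (hy _ (hγ t).1).ne'] using this
    have hne : a - b ≠ 0 := by
      intro h
      have := hline (-1) (by norm_num)
      rw [h, zero_mul, zero_sub, neg_eq_zero] at this
      exact hab ⟨by linarith, by linarith⟩
    have hlt : (-1 : ℝ) < 0 := by norm_num
    have hev : (fun s => (γ s).2) =ᶠ[𝓝 (-1)] fun _ => (1 - b) / (a - b) := by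
      filter_upwards [gt_mem_nhds hlt] with s hs
      rw [eq_div_iff hne]
      linarith [hline s hs]
    have h2 := (hasDerivAt_snd (hd (hγ (-1)).1 (hγ (-1)).2)).unique
      ((hasDerivAt_const _ _).congr_of_eventuallyEq hev)
    have h2 := (mul_eq_zero.1 h2).resolve_left (hkM _ (hγ (-1)).1).1.ne'
    have h1 := hline (-1) hlt
    have hy1 := hy _ (hγ (-1)).1
    refine ⟨γ (-1), (hγ (-1)).1, ?_⟩
    simp only [sqNorm] at h2
    -- On the line, by - b + 1 = ay, so y' = 0 reads y(y - ar) = 0 with r = x² + y²; this kills x'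
    -- too.
    have h3 : (γ (-1)).2 - a * ((γ (-1)).1 ^ 2 + (γ (-1)).2 ^ 2) = 0 := by
      refine (mul_eq_zero.1 (?_ : (γ (-1)).2 * _ = 0)).resolve_left hy1.ne'
      linear_combination h2 - ((γ (-1)).1 ^ 2 + (γ (-1)).2 ^ 2) * h1
    ext
    · simp only [polyField, Prod.fst_zero]; linear_combination (γ (-1)).1 * h3
    · simp only [polyField, Prod.snd_zero]; linear_combination h2

end Invariant

/-! ### Invariance of images and limit sets under reparametrisation -/

section Reparametrisation

variable {E : Type*} {γ : ℝ → E} {I : Set ℝ}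

lemma _root_.IsReparametrisation.image_eq {δ : ℝ → E} {J : Set ℝ} (h : IsReparametrisation γ I δ J) :
    γ '' I = δ '' J := by
  obtain ⟨σ, -, rfl, heq⟩ := h
  rw [heq.image_eq, image_comp]

lemma forwardTrajectory_eq {δ : ℝ → E} {σ : ℝ → ℝ} (hσ : StrictMonoOn σ I)
    (heq : EqOn γ (δ ∘ σ) I) {t : ℝ} (ht : t ∈ I) :
    forwardTrajectory γ I t = forwardTrajectory δ (σ '' I) (σ t) := by
  ext p
  constructor
  · rintro ⟨u, ⟨hu, htu⟩, rfl⟩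
    exact ⟨σ u, ⟨mem_image_of_mem σ hu, hσ.monotoneOn ht hu htu⟩, (heq hu).symm⟩
  · rintro ⟨_, ⟨⟨u, hu, rfl⟩, htu⟩, rfl⟩
    exact ⟨u, ⟨hu, (hσ.le_iff_le ht hu).1 htu⟩, heq hu⟩

lemma _root_.IsReparametrisation.omegaLimitSet_eq [NormedAddCommGroup E] {δ : ℝ → E} {J : Set ℝ}
    (h : IsReparametrisation γ I δ J) : omegaLimitSet γ I = omegaLimitSet δ J := by
  obtain ⟨σ, hσ, rfl, heq⟩ := h
  unfold omegaLimitSet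
  rw [biInter_image]
  refine iInter₂_congr fun t ht => congrArg closure ?_
  exact forwardTrajectory_eq hσ heq ht

end Reparametrisation

/-! ### Time changes of solutions and of maximal solutions -/

section TimeChange

lemma isIntegralCurveOn_iff_hasDerivAt {E : Type*} [NormedAddCommGroup E] [NormedSpace ℝ E]
    {v : E → E} {γ : ℝ → E} {I : Set ℝ} (hI : IsOpen I) :
    IsIntegralCurveOn γ (fun _ => v) I ↔ ∀ t ∈ I, HasDerivAt γ (v (γ t)) t :=
  ⟨fun h t ht => (h t ht).hasDerivAt (hI.mem_nhds ht), fun h t ht => (h t ht).hasDerivWithinAt⟩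

/-- A positive continuous speed on an open interval integrates to an increasing clock with
differentiable inverse. -/
lemma exists_clock {I : Set ℝ} (hI : IsOpen I) (hc : I.OrdConnected) {h : ℝ → ℝ}
    (hh : ContinuousOn h I) (hpos : ∀ t ∈ I, 0 < h t) {s₀ : ℝ} (hs₀ : s₀ ∈ I) (u₀ : ℝ) :
    ∃ T S : ℝ → ℝ, T s₀ = u₀ ∧ (∀ t ∈ I, HasDerivAt T (h t) t) ∧ StrictMonoOn T I ∧
      IsOpen (T '' I) ∧ (T '' I).OrdConnected ∧ (∀ t ∈ I, S (T t) = t) ∧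
      ∀ t ∈ I, HasDerivAt S (h t)⁻¹ (T t) := by
  let T : ℝ → ℝ := fun t => u₀ + ∫ s in s₀..t, h s
  have hT : ∀ t ∈ I, HasDerivAt T (h t) t := fun t ht =>
    (intervalIntegral.integral_hasDerivAt_right
      (hh.mono (hc.uIcc_subset hs₀ ht)).intervalIntegrable
      (hh.stronglyMeasurableAtFilter hI t ht) (hh.continuousAt (hI.mem_nhds ht))).const_add u₀
  have hTc : ContinuousOn T I := fun t ht => (hT t ht).continuousAt.continuousWithinAt
  have hmono : StrictMonoOn T I := by
    refine strictMonoOn_of_deriv_pos hc.convex hTc fun t ht => ?_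
    rw [hI.interior_eq] at ht
    rw [(hT t ht).deriv]
    exact hpos t ht
  have hoc : (T '' I).OrdConnected := (hc.isPreconnected.image T hTc).ordConnected
  have hnhds : ∀ t ∈ I, T '' I ∈ 𝓝 (T t) := by
    intro t ht
    obtain ⟨l, u, ⟨hl, hu⟩, hsub⟩ := mem_nhds_iff_exists_Ioo_subset.1 (hI.mem_nhds ht)
    obtain ⟨t₁, ht₁, ht₁'⟩ := exists_between hl
    obtain ⟨t₂, ht₂, ht₂'⟩ := exists_between hu
    have h1 : t₁ ∈ I := hsub ⟨ht₁, ht₁'.trans hu⟩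
    have h2 : t₂ ∈ I := hsub ⟨hl.trans ht₂, ht₂'⟩
    exact mem_of_superset (Icc_mem_nhds (hmono h1 ht ht₁') (hmono ht h2 ht₂))
      (hoc.out (mem_image_of_mem T h1) (mem_image_of_mem T h2))
  have hopen : IsOpen (T '' I) := isOpen_iff_mem_nhds.2 (by rintro _ ⟨t, ht, rfl⟩; exact hnhds t ht)
  let S : ℝ → ℝ := Function.invFunOn T I
  have hS : ∀ t ∈ I, S (T t) = t := fun t ht => hmono.injOn.leftInvOn_invFunOn ht
  have hSimg : S '' (T '' I) = I := by
    rw [image_image]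
    exact (image_congr hS).trans (image_id' I)
  have hSmono : StrictMonoOn S (T '' I) := by
    rintro _ ⟨t, ht, rfl⟩ _ ⟨u, hu, rfl⟩ htu
    rw [hS t ht, hS u hu]
    exact (hmono.lt_iff_lt ht hu).1 htu
  refine ⟨T, S, by simp [T], hT, hmono, hopen, hoc, hS, fun t ht => ?_⟩
  refine HasDerivAt.of_local_left_inverse (f := T) ?_ ?_ (hpos t ht).ne' ?_
  · refine hSmono.continuousAt_of_image_mem_nhds (hnhds t ht) ?_
    rw [hSimg, hS t ht]
    exact hI.mem_nhds ht
  · rw [hS t ht]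
    exact hT t ht
  · filter_upwards [hnhds t ht]
    rintro _ ⟨u, hu, rfl⟩
    rw [hS u hu]

variable {E : Type*} [NormedAddCommGroup E] [NormedSpace ℝ E] {v w : E → E} {c : E → ℝ}
  {Ω : Set E} {γ : ℝ → E} {I : Set ℝ}

/-- Rescaling the vector field by a positive factor reparametrises its solutions. -/
lemma exists_timeChange (hc : ContinuousOn c Ω) (hpos : ∀ p ∈ Ω, 0 < c p)
    (hw : ∀ p ∈ Ω, w p = c p • v p) (hI : IsOpen I) (hoc : I.OrdConnected)
    (hΩ : MapsTo γ I Ω) (hγ : ∀ t ∈ I, HasDerivAt γ (v (γ t)) t) {s₀ : ℝ} (hs₀ : s₀ ∈ I)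
    (u₀ : ℝ) :
    ∃ T S : ℝ → ℝ, T s₀ = u₀ ∧ (∀ t ∈ I, HasDerivAt T (c (γ t))⁻¹ t) ∧ StrictMonoOn T I ∧
      IsOpen (T '' I) ∧ (T '' I).OrdConnected ∧ (∀ t ∈ I, S (T t) = t) ∧
      MapsTo (γ ∘ S) (T '' I) Ω ∧
      ∀ s ∈ T '' I, HasDerivAt (γ ∘ S) (w ((γ ∘ S) s)) s := by
  have hγc : ContinuousOn γ I := fun t ht => (hγ t ht).continuousAt.continuousWithinAt
  obtain ⟨T, S, h0, hT, hmono, hop, hoc', hS, hS'⟩ := exists_clock hI hoc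
    (h := fun t => (c (γ t))⁻¹)
    ((hc.comp hγc hΩ).inv₀ fun t ht => (hpos _ (hΩ ht)).ne')
    (fun t ht => inv_pos.2 (hpos _ (hΩ ht))) hs₀ u₀
  refine ⟨T, S, h0, hT, hmono, hop, hoc', hS, ?_, ?_⟩
  · rintro _ ⟨t, ht, rfl⟩
    simpa [hS t ht] using hΩ ht
  · rintro _ ⟨t, ht, rfl⟩
    have h1 : HasDerivAt γ (v (γ t)) (S (T t)) := by rw [hS t ht]; exact hγ t ht
    have h2 := h1.scomp (T t) (hS' t ht)
    rw [Function.comp_apply, hS t ht, hw _ (hΩ ht)]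
    simpa using h2

/-- Rescaling the vector field by a positive factor reparametrises its maximal solutions. -/
lemma exists_maximal_reparametrisation (hc : ContinuousOn c Ω) (hpos : ∀ p ∈ Ω, 0 < c p)
    (hw : ∀ p ∈ Ω, w p = c p • v p) (hγ : IsMaximalSolution v Ω γ I) :
    ∃ δ J, IsMaximalSolution w Ω δ J ∧ IsReparametrisation γ I δ J := by
  obtain ⟨s₀, hs₀⟩ := hγ.nonempty
  have hγd := (isIntegralCurveOn_iff_hasDerivAt hγ.isOpen).1 hγ.isIntegralCurveOn
  obtain ⟨T, S, h0, hT, hmono, hop, hoc, hS, hmaps, hδ⟩ :=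
    exists_timeChange hc hpos hw hγ.isOpen hγ.ordConnected hγ.mapsTo hγd hs₀ 0
  refine ⟨γ ∘ S, T '' I, ⟨hop, hoc, hγ.nonempty.image T, hmaps,
    (isIntegralCurveOn_iff_hasDerivAt hop).2 hδ, ?_⟩, T, hmono, rfl,
    fun t ht => by simp [hS t ht]⟩
  intro δ J hJo hJc hsub hJΩ hδJ heq
  have hδd := (isIntegralCurveOn_iff_hasDerivAt hJo).1 hδJ
  obtain ⟨T', S', h0', hT', hmono', hop', hoc', hS', hmaps', hγ'⟩ :=
    exists_timeChange (v := w) (w := v) (c := fun p => (c p)⁻¹)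
      (hc.inv₀ fun p hp => (hpos p hp).ne') (fun p hp => inv_pos.2 (hpos p hp))
      (fun p hp => by rw [hw p hp, smul_smul, inv_mul_cancel₀ (hpos p hp).ne', one_smul])
      hJo hJc hJΩ hδd (hsub (mem_image_of_mem T hs₀)) s₀
  -- The reverse clock is normalised at s₀ and has reciprocal speed, so it undoes T on I. An
  -- extension of the reparametrised curve thus pulls back to an extension of γ.
  have hinv : ∀ t ∈ I, T' (T t) = t := by
    intro t ht
    refine sub_eq_zero.1 (eq_zero_of_norm_deriv_le (f := fun t => T' (T t) - t)
      (f' := fun _ => 0) (M := 0) (s := s₀) (t := t) (fun τ hτ => ?_) (by simp)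
      (by simp [h0']))
    have hτI := hγ.ordConnected.uIcc_subset hs₀ ht hτ
    have hτJ := mem_image_of_mem T hτI
    have h1 := ((hT' _ (hsub hτJ)).comp τ (hT τ hτI)).sub (hasDerivAt_id τ)
    refine h1.congr_deriv ?_
    rw [heq hτJ, Function.comp_apply, hS τ hτI, inv_inv,
      mul_inv_cancel₀ (hpos _ (hγ.mapsTo hτI)).ne', sub_self]
  have hle : T' '' J ⊆ I := by
    refine hγ.maximal (δ ∘ S') (T' '' J) hop' hoc' ?_ hmaps'
      ((isIntegralCurveOn_iff_hasDerivAt hop').2 hγ') ?_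
    · exact fun t ht => ⟨T t, hsub (mem_image_of_mem T ht), hinv t ht⟩
    · intro t ht
      have h1 := hS' _ (hsub (mem_image_of_mem T ht))
      rw [hinv t ht] at h1
      rw [Function.comp_apply, h1, heq (mem_image_of_mem T ht), Function.comp_apply, hS t ht]
  intro s hs
  have ht := hle (mem_image_of_mem T' hs)
  exact ⟨T' s, ht, hmono'.injOn (hsub (mem_image_of_mem T ht)) hs (hinv _ ht)⟩

end TimeChange

/-! ### Homoclinic orbits at the origin for b < 1 -/

section Homoclinic

lemma IsInvariantSet.of_neg {E : Type*} [NormedAddCommGroup E] [NormedSpace ℝ E] {v : E → E}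
    {K : Set E} (h : IsInvariantSet (fun p => -v p) K) : IsInvariantSet v K := by
  intro q hq
  obtain ⟨γ, h0, hγ⟩ := h q hq
  refine ⟨fun t => γ (-t), by simpa using h0, fun t => ⟨(hγ (-t)).1, ?_⟩⟩
  simpa [Function.comp_def] using (hγ (-t)).2.scomp t (hasDerivAt_neg t)

/-- A function that crosses zero only downwards changes sign at most once. -/
lemma neg_of_crossing {f f' : ℝ → ℝ} (hf : ∀ t, HasDerivAt f (f' t) t)
    (hcross : ∀ t, f t = 0 → f' t < 0) (h0 : f 0 = 0) {t : ℝ} (ht : 0 < t) : f t < 0 := by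
  have hle : ∀ s, 0 ≤ s → f s ≤ 0 := fun s hs =>
    image_le_of_deriv_right_lt_deriv_boundary (a := 0) (b := s) (f' := f') (B := fun _ => 0)
      (B' := fun _ => 0) (fun τ _ => (hf τ).continuousAt.continuousWithinAt)
      (fun τ _ => (hf τ).hasDerivWithinAt) h0.le (fun τ => hasDerivAt_const τ 0)
      (fun τ _ h => hcross τ h) ⟨hs, le_rfl⟩
  -- A zero at t > 0 is crossed downwards, so f would be positive just before t.
  refine (hle t ht.le).lt_of_ne fun h => ?_
  have hg : HasDerivAt (fun s => -f (-s)) (f' t) (-t) := by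
    have h1 : HasDerivAt f (f' t) (- -t) := by rw [neg_neg]; exact hf t
    simpa [Function.comp_def] using (h1.scomp (-t) (hasDerivAt_neg (-t))).fun_neg
  have hev := eventually_lt_of_deriv_neg hg (hcross t h)
  have hpos : ∀ᶠ s in 𝓝[>] (-t), s < 0 :=
    (gt_mem_nhds (by linarith : -t < 0)).filter_mono nhdsWithin_le_nhds
  obtain ⟨s, h1, h2⟩ := (hev.and hpos).exists
  rw [neg_neg, h, neg_zero] at h1
  linarith [hle (-s) (by linarith)]

lemma pos_of_crossing {f f' : ℝ → ℝ} (hf : ∀ t, HasDerivAt f (f' t) t)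
    (hcross : ∀ t, f t = 0 → f' t < 0) (h0 : f 0 = 0) {t : ℝ} (ht : t < 0) : 0 < f t := by
  have := neg_of_crossing (f := fun s => -f (-s)) (f' := fun s => f' (-s)) (t := -t)
    (fun s => by simpa [Function.comp_def] using ((hf (-s)).scomp s (hasDerivAt_neg s)).fun_neg)
    (fun s hs => hcross _ (by simpa using hs)) (by simpa using h0) (by linarith)
  simpa using this

variable {a b : ℝ}

lemma exists_stationary_of_invariant_polyField (ha : 0 < a) (hb : 0 < b) {K : Set (ℝ × ℝ)}
    (hK : IsCompact K) (hne : K.Nonempty) (hinv : IsInvariantSet (polyField a b) K) :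
    ∃ q ∈ K, polyField a b q = 0 :=
  exists_stationary_of_invariant (k := fun _ => 1) (M := 1) ha hb hK hne
    (fun _ _ => ⟨one_pos, le_rfl⟩) (fun _ _ => (one_smul ℝ _).symm) hinv

lemma norm_le_sqrt_sqNorm (p : ℝ × ℝ) : ‖p‖ ≤ √(sqNorm p) := by
  rw [Prod.norm_def, max_le_iff, Real.norm_eq_abs, Real.norm_eq_abs]
  constructor <;> refine Real.abs_le_sqrt ?_ <;> unfold sqNorm <;>
    nlinarith [sq_nonneg p.1, sq_nonneg p.2]

lemma sqrt_sqNorm_le (p : ℝ × ℝ) : √(sqNorm p) ≤ 2 * ‖p‖ := by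
  refine Real.sqrt_le_iff.2 ⟨by positivity, ?_⟩
  obtain ⟨h1, h2⟩ := abs_le_of_norm_le (le_refl ‖p‖)
  unfold sqNorm
  nlinarith [sq_le_sq' (abs_le.1 h1).1 (abs_le.1 h1).2, sq_le_sq' (abs_le.1 h2).1 (abs_le.1 h2).2]

/-- A trajectory that stays near an isolated stationary point and along which a proper function
decreases converges to that point. -/
lemma tendsto_zero_of_antitoneOn {v : ℝ × ℝ → ℝ × ℝ} (hv : ContDiff ℝ 1 v)
    {R : ℝ} (hstat : ∀ K : Set (ℝ × ℝ), IsCompact K → K.Nonempty → IsInvariantSet v K →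
      ∃ q ∈ K, polyField a b q = 0)
    (hiso : ∀ q, ‖q‖ ≤ R → polyField a b q = 0 → q = 0) {γ : ℝ → ℝ × ℝ}
    (hγ : ∀ t > 0, HasDerivAt γ (v (γ t)) t) (hR : ∀ t > 0, ‖γ t‖ ≤ R) {φ : ℝ × ℝ → ℝ}
    (hφ : Continuous φ) (hφ0 : φ 0 = 0) (hanti : AntitoneOn (φ ∘ γ) (Ici 0))
    (hle : ∀ t ≥ 0, ‖γ t‖ ≤ 2 * φ (γ t)) : Tendsto γ atTop (𝓝 0) := by
  obtain ⟨hne, hcpt, hinv⟩ := clusterSet_invariant hv hγ hR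
  obtain ⟨q, hq, hq0⟩ := hstat _ hcpt hne hinv
  have hqR : ‖q‖ ≤ R := by
    have := Metric.isClosed_closedBall.mem_of_mapClusterPt (s := Metric.closedBall (0 : ℝ × ℝ) R)
      hq (by filter_upwards [eventually_gt_atTop 0] with t ht; simpa using hR t ht)
    simpa using this
  obtain rfl := hiso q hqR hq0
  -- The origin is a cluster point, so φ becomes small at some time; being antitone, it stays small
  -- and controls the norm.
  rw [Metric.tendsto_atTop]
  intro ε hε
  have hnb : ∀ᶠ p in 𝓝 (0 : ℝ × ℝ), φ p < ε / 2 :=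
    (hφ.tendsto 0).eventually (gt_mem_nhds (by rw [hφ0]; positivity))
  obtain ⟨s, hs, hs'⟩ := frequently_atTop.1 (mapClusterPt_iff_frequently.1 hq _ hnb) 0
  refine ⟨s, fun t hst => ?_⟩
  have h1 : φ (γ t) ≤ φ (γ s) := hanti hs (hs.trans hst) hst
  have hs'' : φ (γ s) < ε / 2 := hs'
  rw [dist_zero_right]
  linarith [hle t (hs.trans hst)]

/-- Near the origin there are no other stationary points. -/
lemma eq_zero_of_polyField_eq_zero (hb : 0 < b) {R : ℝ} (hR1 : R < 1)
    (hR : |a - b| * R < 1 - b) {q : ℝ × ℝ} (hq : ‖q‖ ≤ R) (h : polyField a b q = 0) : q = 0 := by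
  obtain ⟨x, y⟩ := q
  obtain ⟨-, hy⟩ := abs_le_of_norm_le hq
  simp only [polyField, Prod.mk_eq_zero] at h hy ⊢
  obtain ⟨h1, h2⟩ := h
  by_cases hx : x = 0
  · subst hx
    refine ⟨rfl, ?_⟩
    have h3 : y ^ 2 * (b * (1 - y)) = 0 := by linear_combination h2
    have h4 : b * (1 - y) ≠ 0 := by
      have := (abs_le.1 hy).2
      exact (mul_pos hb (by linarith)).ne'
    simpa [h4] using h3
  · exfalso
    have h3 : y = a * (x ^ 2 + y ^ 2) := by
      have : x * (y - a * (x ^ 2 + y ^ 2)) = 0 := by linear_combination h1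
      linarith [(mul_eq_zero.1 this).resolve_left hx]
    have hr : 0 < x ^ 2 + y ^ 2 := by positivity
    have h4 : (a - b) * y = 1 - b := by
      have : (x ^ 2 + y ^ 2) * ((a - b) * y - (1 - b)) = 0 := by
        linear_combination h2 - y * h3
      linarith [(mul_eq_zero.1 this).resolve_left hr.ne']
    have h5 : (a - b) * y ≤ |a - b| * R :=
      (le_abs_self _).trans (by rw [abs_mul]; gcongr)
    linarith

/-- Near the origin, `r - y / 2` increases along trajectories in the upper half plane. -/
lemma sqrt_sub_deriv_nonneg (ha : 0 < a) (hb : 0 < b) {x y r : ℝ}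
    (hr : 0 < r) (hr2 : r ^ 2 = x ^ 2 + y ^ 2) (hy : 0 ≤ y)
    (hrm : 2 * (a + b) * r ≤ min b (1 - b)) :
    0 ≤ 2 * r * (b * y - a * x ^ 2 - b * y ^ 2) - (y ^ 2 - (b * y - b + 1) * r ^ 2) := by
  have hyr : y ≤ r := by nlinarith [sq_nonneg x]
  -- The quadratic part equals (1-b)r(r-y) + bry + y(r-y), which is at least mr²; the negative cubic
  -- part is at most 2(a+b)r³.
  set m := min b (1 - b)
  have hm1 : m ≤ b := min_le_left _ _
  have hm2 : m ≤ 1 - b := min_le_right _ _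
  have h1 : 0 ≤ (1 - b - m) * (r * (r - y)) :=
    mul_nonneg (by linarith) (mul_nonneg hr.le (by linarith))
  have h2 : 0 ≤ (b - m) * (r * y) := mul_nonneg (by linarith) (mul_nonneg hr.le hy)
  have h3 : 0 ≤ y * (r - y) := mul_nonneg hy (by linarith)
  have h4 : 0 ≤ b * y * r ^ 2 := by positivity
  have h5 : 0 ≤ (m - 2 * (a + b) * r) * r ^ 2 := mul_nonneg (by linarith) (by positivity)
  have h6 : a * x ^ 2 + b * y ^ 2 ≤ (a + b) * r ^ 2 := by
    rw [hr2]; nlinarith [mul_nonneg ha.le (sq_nonneg y), mul_nonneg hb.le (sq_nonneg x)]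
  have h7 := mul_le_mul_of_nonneg_left h6 hr.le
  nlinarith

/-- The solution is built for a cut-off field, hence global; the monotone quantities then show that
it never leaves the ball where the cutoff is 1. Returning to y = 0 only at time 0 makes different c
give different orbits. -/
lemma exists_homoclinic (ha : 0 < a) (hb : 0 < b) (hb1 : b < 1) :
    ∃ R₀ > 0, ∀ c ∈ Ioc 0 R₀, ∃ γ : ℝ → ℝ × ℝ, γ 0 = (c, 0) ∧
      IsIntegralCurve γ (fun _ => polyField a b) ∧ (∀ t, γ t ≠ 0) ∧
      (∀ t, (γ t).2 = 0 → t = 0) ∧ Tendsto γ atTop (𝓝 0) ∧ Tendsto γ atBot (𝓝 0) := by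
  have hm : 0 < min b (1 - b) := lt_min hb (by linarith)
  obtain ⟨R, hR, hR1, hR2, hR3⟩ : ∃ R : ℝ, 0 < R ∧ R < 1 ∧ |a - b| * R < 1 - b ∧
      2 * (a + b) * (2 * R) ≤ min b (1 - b) := by
    have h1 : ∀ᶠ R in 𝓝 (0 : ℝ), R < 1 ∧ |a - b| * R < 1 - b ∧
        2 * (a + b) * (2 * R) < min b (1 - b) := by
      refine (gt_mem_nhds one_pos).and (.and ?_ ?_)
      · exact (by fun_prop : Continuous fun R => |a - b| * R).tendsto 0 |>.eventually
          (gt_mem_nhds (by simpa using hb1))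
      · exact (by fun_prop : Continuous fun R => 2 * (a + b) * (2 * R)).tendsto 0 |>.eventually
          (gt_mem_nhds (by simpa using hm))
    obtain ⟨R, ⟨h1, h2, h3⟩, hR⟩ := ((h1.filter_mono nhdsWithin_le_nhds).and
      (self_mem_nhdsWithin (s := Ioi (0 : ℝ)))).exists
    exact ⟨R, hR, h1, h2, h3.le⟩
  have hv := contDiff_polyField a b
  obtain ⟨f, hf0, hf1, hfR, K, C, hK, hC⟩ := exists_cutoff hv (half_pos hR) (half_lt_self hR)
  refine ⟨R / 4, by positivity, fun c ⟨hc, hcR⟩ => ?_⟩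
  obtain ⟨γ, h0, hγ⟩ := exists_isIntegralCurve_of_lipschitzWith hK hC (c, 0)
  have hsq0 : √(sqNorm (γ 0)) = c := by rw [h0]; simp [sqNorm, Real.sqrt_sq hc.le]
  -- A stationary point on the curve would make it constant, but x' = -ac³ ≠ 0 at the start. Hence
  -- the cutoff factor stays positive, and the curve stays in the open ball of radius R.
  have hns : ∀ t, f (γ t) • polyField a b (γ t) ≠ 0 := by
    intro t ht
    have h1 := dist_le_of_lipschitzWith hK (f := γ) (g := fun _ => γ t) (s := t) (t := 0)
      (fun τ _ => hγ τ) (fun τ _ => by simp only [ht]; exact hasDerivAt_const τ _)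
    rw [dist_self, zero_mul] at h1
    have hcn : ‖((c, 0) : ℝ × ℝ)‖ ≤ R / 2 := by
      rw [Prod.norm_def, norm_zero, Real.norm_of_nonneg hc.le, max_eq_left hc.le]
      linarith
    rw [← dist_le_zero.1 h1, h0, hf1 _ hcn, one_smul] at ht
    have h2 := congrArg Prod.fst ht
    simp [polyField, ha.ne', hc.ne'] at h2
  have hfpos : ∀ t, 0 < f (γ t) := fun t =>
    (hf0 _).lt_of_ne fun h => hns t (by rw [← h, zero_smul])
  have hne : ∀ t, γ t ≠ 0 := fun t h => hns t (by rw [h, polyField_zero, smul_zero])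
  have hlt : ∀ t, ‖γ t‖ < R := fun t => by
    by_contra! h
    exact (hfpos t).ne' (hfR _ h)
  have hsq : ∀ t, 0 < sqNorm (γ t) := fun t => sqNorm_pos (hne t)
  have hcross : ∀ t, (γ t).2 = 0 →
      f (γ t) * ((γ t).2 ^ 2 - (b * (γ t).2 - b + 1) * sqNorm (γ t)) < 0 := by
    intro t ht
    rw [ht]
    have := mul_pos (hfpos t) (mul_pos (sub_pos.2 hb1) (hsq t))
    linarith
  have hy0 : (γ 0).2 = 0 := by rw [h0]
  have hneg : ∀ t > 0, (γ t).2 < 0 := fun t ht =>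
    neg_of_crossing (fun t => hasDerivAt_snd (hγ t)) hcross hy0 ht
  have hpos : ∀ t < 0, 0 < (γ t).2 := fun t ht =>
    pos_of_crossing (fun t => hasDerivAt_snd (hγ t)) hcross hy0 ht
  have hrd : ∀ t, HasDerivAt (fun s => √(sqNorm (γ s))) (f (γ t) * (√(sqNorm (γ t)) *
      (b * (γ t).2 - a * (γ t).1 ^ 2 - b * (γ t).2 ^ 2))) t := by
    intro t
    refine ((hasDerivAt_sqNorm (hγ t)).sqrt (hsq t).ne').congr_deriv ?_
    have h1 := (Real.sqrt_pos.2 (hsq t)).ne'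
    have h2 := Real.sq_sqrt (hsq t).le
    field_simp
    rw [h2]
    ring
  have hanti : AntitoneOn (fun s => √(sqNorm (γ s))) (Ici 0) := by
    refine antitoneOn_of_deriv_nonpos (convex_Ici 0)
      (fun t _ => (hrd t).continuousAt.continuousWithinAt)
      (fun t _ => (hrd t).differentiableAt.differentiableWithinAt) fun t ht => ?_
    rw [interior_Ici] at ht
    rw [(hrd t).deriv]
    refine mul_nonpos_of_nonneg_of_nonpos (hfpos t).le
      (mul_nonpos_of_nonneg_of_nonpos (Real.sqrt_nonneg _) ?_)
    nlinarith [mul_pos hb (neg_pos.2 (hneg t ht)), mul_nonneg ha.le (sq_nonneg (γ t).1),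
      mul_nonneg hb.le (sq_nonneg (γ t).2)]
  have hmono : MonotoneOn (fun s => √(sqNorm (γ s)) - (γ s).2 / 2) (Iic 0) := by
    have hd := fun t => (hrd t).sub ((hasDerivAt_snd (hγ t)).div_const 2)
    refine monotoneOn_of_deriv_nonneg (convex_Iic 0)
      (fun t _ => (hd t).continuousAt.continuousWithinAt)
      (fun t _ => (hd t).differentiableAt.differentiableWithinAt) fun t ht => ?_
    rw [interior_Iic] at ht
    refine le_of_le_of_eq ?_ (hd t).deriv.symm
    have h1 := sqrt_sub_deriv_nonneg (x := (γ t).1) (y := (γ t).2) (r := √(sqNorm (γ t))) ha hb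
      (Real.sqrt_pos.2 (hsq t)) (Real.sq_sqrt (hsq t).le) (hpos t ht).le ?_
    · rw [Real.sq_sqrt (hsq t).le] at h1
      nlinarith [mul_nonneg (hfpos t).le h1]
    · refine le_trans ?_ hR3
      have := (sqrt_sqNorm_le (γ t)).trans (mul_le_mul_of_nonneg_left (hlt t).le zero_le_two)
      gcongr
  have hle : ∀ t ≤ 0, √(sqNorm (γ t)) ≤ 2 * (√(sqNorm (γ t)) - (γ t).2 / 2) := by
    intro t _
    have : (γ t).2 ≤ √(sqNorm (γ t)) := Real.le_sqrt_of_sq_le (by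
      unfold sqNorm; nlinarith [sq_nonneg (γ t).1])
    linarith
  -- Forwards r ≤ c; backwards r ≤ 2(r - y/2) ≤ 2c. This is why c ≤ R / 4 is required.
  have hbd : ∀ t, ‖γ t‖ ≤ R / 2 := by
    intro t
    refine (norm_le_sqrt_sqNorm _).trans ?_
    rcases le_total 0 t with ht | ht
    · have := hanti (mem_Ici.2 le_rfl) ht ht
      simp only [hsq0] at this
      linarith
    · have := hmono ht (mem_Iic.2 le_rfl) ht
      simp only [hsq0, hy0] at this
      linarith [hle t ht]
  have hsol : ∀ t, HasDerivAt γ (polyField a b (γ t)) t := fun t => by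
    have : HasDerivAt γ (f (γ t) • polyField a b (γ t)) t := hγ t
    rwa [hf1 _ (hbd t), one_smul] at this
  have hiso : ∀ q, ‖q‖ ≤ R / 2 → polyField a b q = 0 → q = 0 := fun q hq =>
    eq_zero_of_polyField_eq_zero hb hR1 hR2 (hq.trans (half_le_self hR.le))
  have hcont := continuous_sqNorm
  refine ⟨γ, h0, hsol, hne, fun t ht => ?_, ?_, ?_⟩
  · rcases lt_trichotomy t 0 with h | h | h
    · exact absurd ht (hpos t h).ne'
    · exact h
    · exact absurd ht (hneg t h).ne
  · refine tendsto_zero_of_antitoneOn hv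
      (fun L => exists_stationary_of_invariant_polyField ha hb) hiso (fun t _ => hsol t)
      (fun t _ => hbd t) (φ := fun p => √(sqNorm p)) (by fun_prop) (by simp [sqNorm]) hanti
      fun t _ => ?_
    linarith [norm_le_sqrt_sqNorm (γ t), Real.sqrt_nonneg (sqNorm (γ t))]
  · have hrev : Tendsto (fun t => γ (-t)) atTop (𝓝 0) := by
      refine tendsto_zero_of_antitoneOn (v := fun p => -polyField a b p) hv.neg
        (fun L hL hne hinv => exists_stationary_of_invariant_polyField ha hb hL hne hinv.of_neg)
        hiso (fun t _ => ?_) (fun t _ => hbd (-t)) (φ := fun p => √(sqNorm p) - p.2 / 2)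
        (by fun_prop) (by simp [sqNorm]) ?_ fun t ht => ?_
      · simpa [Function.comp_def] using (hsol (-t)).scomp t (hasDerivAt_neg t)
      · intro s hs t ht hst
        exact hmono (mem_Iic.2 (neg_nonpos.2 ht)) (mem_Iic.2 (neg_nonpos.2 hs)) (neg_le_neg hst)
      · exact (norm_le_sqrt_sqNorm _).trans (hle (-t) (neg_nonpos.2 ht))
    simpa [Function.comp_def] using hrev.comp tendsto_neg_atBot_atTop

lemma infinite_homoclinic (ha : 0 < a) (hb : 0 < b) (hb1 : b < 1) :
    {O | IsHomoclinicOrbit (polyField a b) 0 O}.Infinite := by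
  obtain ⟨R, hR, h⟩ := exists_homoclinic ha hb hb1
  choose! γ h0 hγ hne hcross htop hbot using h
  refine infinite_of_injOn_mapsTo (s := Ioc 0 R) (f := fun c => range (γ c)) ?_ ?_
    (Ioc_infinite hR)
  · intro c hc d hd hcd
    have hmem : (d, 0) ∈ range (γ c) := by
      have : range (γ c) = range (γ d) := hcd
      rw [this, ← h0 d hd]
      exact mem_range_self 0
    obtain ⟨t, ht⟩ := hmem
    have ht0 := hcross c hc t (by rw [ht])
    rw [ht0, h0 c hc] at ht
    exact congrArg Prod.fst ht
  · intro c hc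
    refine ⟨polyField_zero a b, γ c, hγ c hc, rfl, ?_, htop c hc, hbot c hc⟩
    rintro ⟨t, ht⟩
    exact hne c hc t ht

end Homoclinic

/-! ### Limit sets of convergent curves -/

section LimitSets

variable {E : Type*} [NormedAddCommGroup E] {γ : ℝ → E} {I : Set ℝ}

lemma mem_omegaLimitSet_of_mapClusterPt {t₀ : ℝ} (hI : Ici t₀ ⊆ I) {q : E}
    (hq : MapClusterPt q atTop γ) : q ∈ omegaLimitSet γ I := by
  refine mem_iInter₂.2 fun s _ => isClosed_closure.mem_of_mapClusterPt hq ?_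
  filter_upwards [eventually_ge_atTop t₀, eventually_ge_atTop s] with t h1 h2
  exact subset_closure ⟨t, ⟨hI h1, h2⟩, rfl⟩

lemma omegaLimitSet_eq_of_tendsto {p : E} (h : Tendsto γ atTop (𝓝 p)) :
    omegaLimitSet γ univ = {p} := by
  refine Subset.antisymm (fun q hq => ?_) (singleton_subset_iff.2
    (mem_omegaLimitSet_of_mapClusterPt (subset_univ (Ici 0)) h.mapClusterPt))
  refine dist_le_zero.1 (le_of_forall_pos_le_add fun ε hε => ?_)
  obtain ⟨s, hs⟩ := Metric.tendsto_atTop.1 h ε hε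
  have hsub : closure (forwardTrajectory γ univ s) ⊆ Metric.closedBall p ε :=
    closure_minimal (by rintro _ ⟨t, ⟨-, ht⟩, rfl⟩; exact (hs t ht).le) Metric.isClosed_closedBall
  simpa using hsub (mem_iInter₂.1 hq s (mem_univ s))

lemma isBounded_range_of_tendsto {p q : E} (hγ : Continuous γ) (htop : Tendsto γ atTop (𝓝 p))
    (hbot : Tendsto γ atBot (𝓝 q)) : Bornology.IsBounded (range γ) := by
  obtain ⟨A, hA⟩ := eventually_atTop.1 (htop.eventually (Metric.ball_mem_nhds p one_pos))
  obtain ⟨B, hB⟩ := eventually_atBot.1 (hbot.eventually (Metric.ball_mem_nhds q one_pos))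
  refine (((Metric.isBounded_ball (x := p) (r := 1)).union
    (Metric.isBounded_ball (x := q) (r := 1))).union
    ((isCompact_Icc (a := B) (b := A)).image hγ).isBounded).subset ?_
  rintro _ ⟨t, rfl⟩
  rcases le_total A t with h | h
  · exact .inl (.inl (hA t h))
  rcases le_total t B with h' | h'
  · exact .inl (.inr (hB t h'))
  · exact .inr ⟨t, ⟨h', h⟩, rfl⟩

end LimitSets

/-! ### Maximal solutions: continuation, uniqueness, removal of a stationary point -/

section Maximal

variable {E : Type*} [NormedAddCommGroup E] [NormedSpace ℝ E] {v : E → E} {γ : ℝ → E} {I : Set ℝ}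

lemma isMaximalSolution_univ (hγ : IsIntegralCurve γ (fun _ => v)) :
    IsMaximalSolution v univ γ univ where
  isOpen := isOpen_univ
  ordConnected := ordConnected_univ
  nonempty := univ_nonempty
  mapsTo := mapsTo_univ _ _
  isIntegralCurveOn := hγ.isIntegralCurveOn _
  maximal _ _ _ _ _ _ _ _ := subset_univ _

lemma _root_.IsMaximalSolution.hasDerivAt {Ω : Set E} (h : IsMaximalSolution v Ω γ I) {t : ℝ}
    (ht : t ∈ I) : HasDerivAt γ (v (γ t)) t :=
  (isIntegralCurveOn_iff_hasDerivAt h.isOpen).1 h.isIntegralCurveOn t ht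

variable [FiniteDimensional ℝ E]

/-- A maximal solution with a bounded forward trajectory exists for all future times. -/
lemma Ici_subset_of_isBounded (hv : ContDiff ℝ 1 v) (hγ : IsMaximalSolution v univ γ I) {t₀ : ℝ}
    (ht₀ : t₀ ∈ I) (hbd : Bornology.IsBounded (forwardTrajectory γ I t₀)) : Ici t₀ ⊆ I := by
  by_contra hcon
  obtain ⟨t₁, ht₁, ht₁I⟩ := not_subset.1 hcon
  have hoc := hγ.ordConnected
  obtain ⟨R, hR⟩ := hbd.exists_norm_le
  have hR' : ∀ t ∈ I, t₀ ≤ t → ‖γ t‖ ≤ R := fun t ht h => hR _ ⟨t, ⟨ht, h⟩, rfl⟩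
  -- The margin 1 lets the global solution δ of F still solve the original equation a little beyond
  -- the supremum of I, so gluing it to γ contradicts maximality.
  obtain ⟨F, K, C, hK, hC, hF⟩ := exists_lipschitz_extension hv (R + 1)
  obtain ⟨δ', h0', hδ'⟩ := exists_isIntegralCurve_of_lipschitzWith hK hC (γ t₀)
  obtain ⟨δ, h0, hδ⟩ : ∃ δ : ℝ → E, δ t₀ = γ t₀ ∧ ∀ t, HasDerivAt δ (F (δ t)) t :=
    ⟨fun t => δ' (t - t₀), by simpa using h0', fun t => (hδ' (t - t₀)).comp_sub_const t t₀⟩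
  have hagree : ∀ t ∈ I, t₀ ≤ t → δ t = γ t := by
    intro t ht h
    have := dist_le_of_lipschitzWith hK (f := δ) (g := γ) (s := t₀) (t := t) (fun τ _ => hδ τ)
      fun τ hτ => by
        have hτI := hoc.uIcc_subset ht₀ ht hτ
        rw [uIcc_of_le h] at hτ
        rw [hF _ ((hR' τ hτI hτ.1).trans (by linarith))]
        exact hγ.hasDerivAt hτI
    rw [h0, dist_self, zero_mul] at this
    exact dist_le_zero.1 this
  have hub : ∀ t ∈ I, t < t₁ := fun t ht => by
    by_contra! h
    exact ht₁I (hoc.out ht₀ ht ⟨ht₁, h⟩)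
  have hlub : IsLUB I (sSup I) := isLUB_csSup hγ.nonempty ⟨t₁, fun t ht => (hub t ht).le⟩
  set T := sSup I
  have hTI : T ∉ I := fun h => by
    obtain ⟨u, hu, hsub⟩ := exists_Ico_subset_of_mem_nhds (hγ.isOpen.mem_nhds h) (exists_gt T)
    obtain ⟨s, hs, hs'⟩ := exists_between hu
    exact absurd (hlub.1 (hsub ⟨hs.le, hs'⟩)) (not_le.2 hs)
  have hIT : ∀ t, t₀ ≤ t → t < T → t ∈ I := fun t h h' => by
    obtain ⟨s, hs, hts⟩ := (lt_isLUB_iff hlub).1 h'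
    exact hoc.out ht₀ hs ⟨h, hts.le⟩
  have hlt : ∀ t ∈ I, t < T := fun t ht => (hlub.1 ht).lt_of_ne fun h => hTI (h ▸ ht)
  have hδc : Continuous δ := continuous_iff_continuousAt.2 fun t => (hδ t).continuousAt
  have hδT : ‖δ T‖ ≤ R := by
    refine le_of_tendsto ((hδc.norm.tendsto T).mono_left (nhdsWithin_le_nhds (s := Iio T))) ?_
    have : ∀ᶠ t in 𝓝[<] T, t₀ < t := (lt_mem_nhds (hlt t₀ ht₀)).filter_mono nhdsWithin_le_nhds
    filter_upwards [this, self_mem_nhdsWithin] with t h1 h2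
    rw [hagree t (hIT t h1.le h2) h1.le]
    exact hR' t (hIT t h1.le h2) h1.le
  obtain ⟨u, hTu, hu⟩ : ∃ u, T < u ∧ ∀ t ∈ Ico T u, ‖δ t‖ < R + 1 := by
    have := (hδc.norm.tendsto T).eventually (gt_mem_nhds (hδT.trans_lt (lt_add_one R)))
    exact exists_Ico_subset_of_mem_nhds this (exists_gt T)
  have hδv : ∀ t ∈ Ioo t₀ u, HasDerivAt δ (v (δ t)) t := by
    intro t ht
    rw [← hF (δ t)]
    · exact hδ t
    · rcases lt_or_ge t T with h | h
      · rw [hagree t (hIT t ht.1.le h) ht.1.le]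
        exact (hR' t (hIT t ht.1.le h) ht.1.le).trans (by linarith)
      · exact (hu t ⟨h, ht.2⟩).le
  classical
  let η : ℝ → E := fun t => if t ∈ I then γ t else δ t
  have hηγ : EqOn η γ I := fun t ht => if_pos ht
  have hηδ : EqOn η δ (Ioo t₀ u) := fun t ht => by
    by_cases h : t ∈ I
    · rw [hηγ h, hagree t h ht.1.le]
    · exact if_neg h
  have hop : IsOpen (I ∪ Ioo t₀ u) := hγ.isOpen.union isOpen_Ioo
  have hconn : (I ∪ Ioo t₀ u).OrdConnected := by
    obtain ⟨s, hs, hs'⟩ := exists_between (hlt t₀ ht₀)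
    exact (IsPreconnected.union s (hIT s hs.le hs') (mem_Ioo.2 ⟨hs, hs'.trans hTu⟩)
      hoc.isPreconnected isPreconnected_Ioo).ordConnected
  have := hγ.maximal η (I ∪ Ioo t₀ u) hop hconn subset_union_left (mapsTo_univ _ _)
    ((isIntegralCurveOn_iff_hasDerivAt hop).2 fun t ht => ?_) hηγ
  · exact hTI (this (.inr ⟨hlt t₀ ht₀, hTu⟩))
  · rcases ht with ht | ht
    · rw [hηγ ht]
      exact (hγ.hasDerivAt ht).congr_of_eventuallyEq (hηγ.eventuallyEq_of_mem (hγ.isOpen.mem_nhds ht))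
    · rw [hηδ ht]
      exact (hδv t ht).congr_of_eventuallyEq (hηδ.eventuallyEq_of_mem (isOpen_Ioo.mem_nhds ht))

/-- A maximal solution whose orbit meets that of a global solution is a time shift of it. -/
lemma _root_.IsMaximalSolution.eq_shift (hv : ContDiff ℝ 1 v) (hγ : IsMaximalSolution v univ γ I)
    {δ : ℝ → E} (hδ : IsIntegralCurve δ (fun _ => v)) {s s' : ℝ} (hs : s ∈ I) (h : γ s = δ s') :
    I = univ ∧ ∀ t, γ t = δ (t + (s' - s)) := by
  have hδ' : IsIntegralCurve (fun t => δ (t + (s' - s))) (fun _ => v) := fun t =>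
    (hδ (t + (s' - s))).comp_add_const t _
  have heq : EqOn (fun t => δ (t + (s' - s))) γ I :=
    eqOn_of_contDiff hv hγ.ordConnected (fun t _ => hδ' t) (fun t ht => hγ.hasDerivAt ht) hs
      (by simp [h])
  have hI : I = univ := univ_subset_iff.1 (hγ.maximal _ univ isOpen_univ ordConnected_univ
    (subset_univ _) (mapsTo_univ _ _) (hδ'.isIntegralCurveOn _) heq)
  exact ⟨hI, fun t => (heq (hI ▸ mem_univ t)).symm⟩

/-- Away from a stationary point `p`, maximal solutions in the whole space and in the complement
of `p` are the same. -/
lemma isMaximalSolution_compl_singleton_iff (hv : ContDiff ℝ 1 v) {p : E} (hp : v p = 0) :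
    IsMaximalSolution v {p}ᶜ γ I ↔ IsMaximalSolution v univ γ I ∧ γ '' I ≠ {p} := by
  -- By uniqueness a solution that reaches p is constantly p.
  have havoid : ∀ {δ : ℝ → E} {J : Set ℝ}, J.OrdConnected →
      (∀ t ∈ J, HasDerivAt δ (v (δ t)) t) → (∃ t ∈ J, δ t ≠ p) → MapsTo δ J {p}ᶜ := by
    rintro δ J hJ hδ ⟨t, ht, hne⟩ s hs hsp
    rw [mem_singleton_iff] at hsp
    exact hne ((eq_of_stationary hv hJ hδ hs (by rw [hsp, hp]) t ht).trans hsp)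
  constructor
  · intro h
    obtain ⟨t, ht⟩ := h.nonempty
    refine ⟨⟨h.isOpen, h.ordConnected, h.nonempty, mapsTo_univ _ _, h.isIntegralCurveOn, ?_⟩, ?_⟩
    · intro δ J hJo hJc hsub _ hδ heq
      refine h.maximal δ J hJo hJc hsub (havoid hJc
        ((isIntegralCurveOn_iff_hasDerivAt hJo).1 hδ) ⟨t, hsub ht, ?_⟩) hδ heq
      rw [heq ht]
      exact h.mapsTo ht
    · intro himg
      exact h.mapsTo ht (himg ▸ mem_image_of_mem γ ht)
  · rintro ⟨h, himg⟩
    refine ⟨h.isOpen, h.ordConnected, h.nonempty, havoid h.ordConnected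
      (fun t ht => h.hasDerivAt ht) ?_, h.isIntegralCurveOn, fun δ J hJo hJc hsub _ =>
      h.maximal δ J hJo hJc hsub (mapsTo_univ _ _)⟩
    by_contra! hcon
    exact himg (Subset.antisymm (by rintro _ ⟨t, ht, rfl⟩; exact hcon t ht)
      (singleton_subset_iff.2 (h.nonempty.imp fun t ht => ⟨ht, hcon t ht⟩)))

end Maximal

/-! ### The two systems: orbits, limit sets, absence of chaos -/

section System

variable {a b : ℝ}

lemma exists_mvPolynomial_polyField (a b : ℝ) :
    ∃ P Q : MvPolynomial (Fin 2) ℝ, ∀ x y : ℝ,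
      polyField a b (x, y) = (MvPolynomial.eval ![x, y] P, MvPolynomial.eval ![x, y] Q) := by
  open MvPolynomial in
  refine ⟨X 0 * X 1 - C a * (X 0 ^ 3 + X 0 * X 1 ^ 2),
    X 1 ^ 2 - (C b * X 1 - C b + 1) * (X 0 ^ 2 + X 1 ^ 2), fun x y => ?_⟩
  simp [polyField]

lemma exists_polyField_of_cdkField {γ : ℝ → ℝ × ℝ} {I : Set ℝ}
    (h : IsMaximalSolution (cdkField a b) {0}ᶜ γ I) :
    ∃ δ J, IsMaximalSolution (polyField a b) univ δ J ∧ IsReparametrisation γ I δ J := by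
  obtain ⟨δ, J, hδ, hrep⟩ := exists_maximal_reparametrisation (w := polyField a b)
    continuous_sqNorm.continuousOn (fun p hp => sqNorm_pos hp)
    (fun p hp => polyField_eq_smul a b hp) h
  exact ⟨δ, J, ((isMaximalSolution_compl_singleton_iff (contDiff_polyField a b)
    (polyField_zero a b)).1 hδ).1, hrep⟩

lemma exists_cdkField_of_polyField {δ : ℝ → ℝ × ℝ} {J : Set ℝ}
    (h : IsMaximalSolution (polyField a b) univ δ J) (hne : δ '' J ≠ {0}) :
    ∃ γ I, IsMaximalSolution (cdkField a b) {0}ᶜ γ I ∧ IsReparametrisation γ I δ J := by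
  obtain ⟨γ, I, hγ, σ, hσ, himg, heq⟩ := exists_maximal_reparametrisation (w := cdkField a b)
    (continuous_sqNorm.continuousOn.inv₀ fun p hp => (sqNorm_pos hp).ne')
    (fun p hp => inv_pos.2 (sqNorm_pos hp)) (fun p hp => cdkField_eq_smul a b hp)
    ((isMaximalSolution_compl_singleton_iff (contDiff_polyField a b)
      (polyField_zero a b)).2 ⟨h, hne⟩)
  have hinv := hσ.injOn.leftInvOn_invFunOn
  refine ⟨γ, I, hγ, Function.invFunOn σ J, ?_, ?_, ?_⟩
  · rw [← himg]
    rintro _ ⟨t, ht, rfl⟩ _ ⟨u, hu, rfl⟩ htu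
    rw [hinv ht, hinv hu]
    exact (hσ.lt_iff_lt ht hu).1 htu
  · rw [← himg, image_image]
    exact (image_congr hinv).trans (image_id' J)
  · rw [← himg]
    rintro _ ⟨t, ht, rfl⟩
    rw [Function.comp_apply, hinv ht, heq ht, Function.comp_apply]

lemma setOf_isOrbit_cdkField (a b : ℝ) :
    {O | IsOrbit (cdkField a b) {0}ᶜ O} = {O | IsOrbit (polyField a b) univ O ∧ O ≠ {0}} := by
  ext O
  constructor
  · rintro ⟨γ, I, hγ, rfl⟩
    obtain ⟨δ, J, hδ, hrep⟩ := exists_polyField_of_cdkField hγ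
    refine ⟨⟨δ, J, hδ, hrep.image_eq⟩, fun h => ?_⟩
    obtain ⟨t, ht⟩ := hγ.nonempty
    exact hγ.mapsTo ht (h ▸ mem_image_of_mem γ ht)
  · rintro ⟨⟨δ, J, hδ, rfl⟩, hne⟩
    obtain ⟨γ, I, hγ, hrep⟩ := exists_cdkField_of_polyField hδ hne
    exact ⟨γ, I, hγ, hrep.image_eq.symm⟩

/-- The `ω`-limit set of a bounded forward trajectory contains a stationary point. -/
lemma exists_stationary_mem_omegaLimitSet (ha : 0 < a) (hb : 0 < b) {γ : ℝ → ℝ × ℝ} {I : Set ℝ}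
    (hγ : IsMaximalSolution (polyField a b) univ γ I) {t₀ : ℝ} (ht₀ : t₀ ∈ I)
    (hbd : Bornology.IsBounded (forwardTrajectory γ I t₀)) :
    ∃ p ∈ omegaLimitSet γ I, polyField a b p = 0 := by
  have hv := contDiff_polyField a b
  have hsub := Ici_subset_of_isBounded hv hγ ht₀ hbd
  obtain ⟨R, hR⟩ := hbd.exists_norm_le
  obtain ⟨hne, hcpt, hinv⟩ := clusterSet_invariant hv (t₀ := t₀) (R := R)
    (fun t ht => hγ.hasDerivAt (hsub (mem_Ici.2 ht.le)))
    (fun t ht => hR _ ⟨t, ⟨hsub (mem_Ici.2 ht.le), ht.le⟩, rfl⟩)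
  obtain ⟨q, hq, hq0⟩ := exists_stationary_of_invariant_polyField ha hb hcpt hne hinv
  exact ⟨q, mem_omegaLimitSet_of_mapClusterPt hsub hq, hq0⟩

/-- Positive multiples of the polynomial field have no chaotic sets: all periodic points in a
compact invariant set are stationary. -/
lemma not_isChaoticSet (ha : 0 < a) (hb : 0 < b) {v : ℝ × ℝ → ℝ × ℝ} {Ω Λ : Set (ℝ × ℝ)}
    {k : ℝ × ℝ → ℝ} (hk : ContinuousOn k Ω) (hkpos : ∀ p ∈ Ω, 0 < k p)
    (hv : ∀ p ∈ Ω, v p = k p • polyField a b p) : ¬ IsChaoticSet v Ω Λ := by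
  rintro ⟨⟨x₀, hx₀⟩, hΛ, hΛΩ, φ, hφ, ⟨ε, hε, hsens⟩, -, hdense⟩
  obtain ⟨M, hM⟩ := hΛ.exists_bound_of_continuousOn (hk.mono hΛΩ)
  have hkM : ∀ p ∈ Λ, 0 < k p ∧ k p ≤ M := fun p hp =>
    ⟨hkpos p (hΛΩ hp), (le_abs_self _).trans (hM p hp)⟩
  obtain ⟨R, hR⟩ := hΛ.isBounded.exists_norm_le
  obtain ⟨F, L, -, hL, -, hF⟩ := exists_lipschitz_extension (contDiff_polyField a b) R
  -- A periodic orbit is compact and invariant, so it contains a stationary point and reduces to it.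
  -- As k is merely continuous, uniqueness comes from a Lipschitz bound on the polynomial field
  -- times the bound M on k.
  have hstat : ∀ x : Λ, (∃ T > 0, φ T x = x) → ∀ t, φ t x = x := by
    rintro x ⟨T, hT, hTx⟩
    have hcont : Continuous fun t => (φ t x : ℝ × ℝ) :=
      continuous_subtype_val.comp (φ.continuous continuous_id continuous_const)
    have hper : Function.Periodic (fun t => (φ t x : ℝ × ℝ)) T := fun t => by
      simp only [φ.map_add, hTx]
    have hcpt : IsCompact (range fun t => (φ t x : ℝ × ℝ)) :=
      hper.compact_of_continuous hT.ne' hcont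
    have hsub : (range fun t => (φ t x : ℝ × ℝ)) ⊆ Λ := by
      rintro _ ⟨t, rfl⟩; exact (φ t x).2
    have hinv : IsInvariantSet v (range fun t => (φ t x : ℝ × ℝ)) := by
      rintro _ ⟨s, rfl⟩
      refine ⟨fun t => φ t (φ s x), by simp, fun t => ⟨⟨t + s, ?_⟩, hφ _ t⟩⟩
      simp only [φ.map_add]
    obtain ⟨_, ⟨s, rfl⟩, hs⟩ := exists_stationary_of_invariant ha hb hcpt (range_nonempty _)
      (fun p hp => hkM p (hsub hp)) (fun p hp => hv p (hΛΩ (hsub hp))) hinv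
    have hconst : ∀ t, (φ t x : ℝ × ℝ) = φ s x := by
      intro t
      refine sub_eq_zero.1 (eq_zero_of_norm_deriv_le (f := fun t => (φ t x : ℝ × ℝ) - φ s x)
        (f' := fun t => v (φ t x)) (M := M * L) (s := s) (fun τ _ => (hφ x τ).sub_const _)
        (fun τ _ => ?_) (sub_self _))
      have hτ := (φ τ x).2
      obtain ⟨h1, h2⟩ := hkM _ hτ
      have h3 := hL.norm_sub_le (φ τ x : ℝ × ℝ) (φ s x)
      rw [hF _ (hR _ hτ), hF _ (hR _ (φ s x).2), hs, sub_zero] at h3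
      rw [hv _ (hΛΩ hτ), norm_smul, Real.norm_of_nonneg h1.le, mul_assoc]
      exact mul_le_mul h2 h3 (norm_nonneg _) (h1.le.trans h2)
    intro t
    have h0 := hconst 0
    rw [φ.map_zero_apply] at h0
    exact Subtype.ext ((hconst t).trans h0.symm)
  have hall : ∀ x : Λ, ∀ t, φ t x = x := by
    intro x t
    have hcl : IsClosed {x : Λ | φ t x = x} :=
      isClosed_eq (φ.continuous continuous_const continuous_id) continuous_id
    exact hcl.closure_subset_iff.2 (fun y hy => hstat y hy t) (hdense x)
  -- The flow is the identity, so points of the ε-ball never separate by more than ε.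
  obtain ⟨y, hy, t, -, ht⟩ := hsens ⟨x₀, hx₀⟩ _ (Metric.ball_mem_nhds _ hε)
  rw [hall, hall, dist_comm] at ht
  exact absurd ht (not_lt.2 (Metric.mem_ball.1 hy).le)

lemma _root_.IsHomoclinicOrbit.isOrbit_polyField {O : Set (ℝ × ℝ)}
    (h : IsHomoclinicOrbit (polyField a b) 0 O) : IsOrbit (polyField a b) univ O ∧ O ≠ {0} := by
  obtain ⟨-, δ, hδ, rfl, h0, -, -⟩ := h
  exact ⟨⟨δ, univ, isMaximalSolution_univ hδ, image_univ.symm⟩,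
    fun h => h0 (h ▸ mem_singleton _)⟩

lemma _root_.IsHomoclinicOrbit.omegaLimitSet_eq {O : Set (ℝ × ℝ)}
    (h : IsHomoclinicOrbit (polyField a b) 0 O) {γ : ℝ → ℝ × ℝ} {I : Set ℝ}
    (hγ : IsMaximalSolution (cdkField a b) {0}ᶜ γ I) (hO : γ '' I = O) :
    omegaLimitSet γ I = {0} := by
  obtain ⟨-, δ, hδ, rfl, -, htop, -⟩ := h
  obtain ⟨η, J, hη, hrep⟩ := exists_polyField_of_cdkField hγ
  obtain ⟨s, hs⟩ := hη.nonempty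
  have hmem : η s ∈ range δ := by
    rw [← hO, hrep.image_eq]
    exact mem_image_of_mem η hs
  obtain ⟨s', hs'⟩ := hmem
  obtain ⟨rfl, heq⟩ := hη.eq_shift (contDiff_polyField a b) hδ hs hs'.symm
  rw [hrep.omegaLimitSet_eq]
  refine omegaLimitSet_eq_of_tendsto ?_
  rw [funext heq]
  exact htop.comp (tendsto_atTop_add_const_right _ _ tendsto_id)

end System

end CDK

theorem mainTheorem3 (a b : ℝ) (ha : 0 < a) (hb : 0 < b) :
    -- the system `polyField` is polynomial, hence `C¹`, on the whole plane
    (∃ P Q : MvPolynomial (Fin 2) ℝ, ∀ x y : ℝ,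
      polyField a b (x, y) = (MvPolynomial.eval ![x, y] P, MvPolynomial.eval ![x, y] Q)) ∧
    ContDiff ℝ 1 (polyField a b) ∧
    -- apart from the stationary point at the origin, the two systems have the same orbits,
    -- with the same orientation
    polyField a b 0 = 0 ∧
    {O | IsOrbit (cdkField a b) {0}ᶜ O} = {O | IsOrbit (polyField a b) univ O ∧ O ≠ {0}} ∧
    (∀ γ I, IsMaximalSolution (cdkField a b) {0}ᶜ γ I →
      ∃ δ J, IsMaximalSolution (polyField a b) univ δ J ∧ IsReparametrisation γ I δ J) ∧
    (∀ δ J, IsMaximalSolution (polyField a b) univ δ J → δ '' J ≠ {0} →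
      ∃ γ I, IsMaximalSolution (cdkField a b) {0}ᶜ γ I ∧ IsReparametrisation γ I δ J) ∧
    -- the Poincaré–Bendixson alternative for bounded forward trajectories of the polynomial system
    (∀ γ I, IsMaximalSolution (polyField a b) univ γ I →
      ∀ t₀ ∈ I, Bornology.IsBounded (forwardTrajectory γ I t₀) →
        (∃ p ∈ omegaLimitSet γ I, polyField a b p = 0) ∨
          IsPeriodicOrbit (polyField a b) univ (omegaLimitSet γ I)) ∧
    -- and for bounded forward trajectories of the CDK system
    (∀ γ I, IsMaximalSolution (cdkField a b) {0}ᶜ γ I →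
      ∀ t₀ ∈ I, Bornology.IsBounded (forwardTrajectory γ I t₀) →
        (0 ∈ omegaLimitSet γ I ∨ ∃ p ∈ omegaLimitSet γ I, p ≠ 0 ∧ cdkField a b p = 0) ∨
          IsPeriodicOrbit (cdkField a b) {0}ᶜ (omegaLimitSet γ I)) ∧
    -- there are no chaotic sets
    (∀ Λ, ¬ IsChaoticSet (cdkField a b) {0}ᶜ Λ) ∧
    (∀ Λ, ¬ IsChaoticSet (polyField a b) univ Λ) ∧
    -- for `b < 1` there are infinitely many homoclinic orbits at the origin; they are bounded orbits
    -- of the CDK system with no forward part inside a compact subset of the punctured plane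
    (b < 1 →
      {O | IsHomoclinicOrbit (polyField a b) 0 O}.Infinite ∧
      ∀ O, IsHomoclinicOrbit (polyField a b) 0 O →
        IsOrbit (cdkField a b) {0}ᶜ O ∧ Bornology.IsBounded O ∧
        ∀ γ I, IsMaximalSolution (cdkField a b) {0}ᶜ γ I → γ '' I = O →
          omegaLimitSet γ I = {0} ∧
          ∀ t₀ ∈ I, ∀ K : Set (ℝ × ℝ), IsCompact K → forwardTrajectory γ I t₀ ⊆ K →
            ¬ K ⊆ {0}ᶜ) := by

  open CDK in
  refine ⟨exists_mvPolynomial_polyField a b, contDiff_polyField a b, polyField_zero a b,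
    setOf_isOrbit_cdkField a b, fun γ I h => exists_polyField_of_cdkField h,
    fun δ J h hne => exists_cdkField_of_polyField h hne, fun γ I hγ t₀ ht₀ hbd =>
    .inl (exists_stationary_mem_omegaLimitSet ha hb hγ ht₀ hbd), fun γ I hγ t₀ ht₀ hbd => .inl ?_,
    fun Λ => not_isChaoticSet ha hb (k := fun p => (sqNorm p)⁻¹)
      (continuous_sqNorm.continuousOn.inv₀ fun p hp => (sqNorm_pos hp).ne')
      (fun p hp => inv_pos.2 (sqNorm_pos hp)) (fun p hp => cdkField_eq_smul a b hp),
    fun Λ => not_isChaoticSet ha hb (k := fun _ => 1) continuousOn_const (fun _ _ => one_pos)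
      (fun _ _ => (one_smul ℝ _).symm),
    fun hb1 => ⟨infinite_homoclinic ha hb hb1, fun O hO => ⟨?_, ?_, fun γ I hγ hγO => ⟨?_, ?_⟩⟩⟩⟩
  -- Limit sets survive the time change, and a stationary point of the polynomial field is either 0
  -- or stationary for the CDK field.
  · obtain ⟨δ, J, hδ, hrep⟩ := exists_polyField_of_cdkField hγ
    rw [hrep.omegaLimitSet_eq]
    obtain ⟨σ, hσ, rfl, heq⟩ := hrep
    rw [forwardTrajectory_eq hσ heq ht₀] at hbd
    obtain ⟨p, hp, hp0⟩ :=
      exists_stationary_mem_omegaLimitSet ha hb hδ (mem_image_of_mem σ ht₀) hbd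
    by_cases h : p = 0
    · exact .inl (h ▸ hp)
    · exact .inr ⟨p, hp, h, by rw [cdkField_eq_smul a b h, hp0, smul_zero]⟩
  · exact (Set.ext_iff.1 (setOf_isOrbit_cdkField a b) O).2 (hO.isOrbit_polyField)
  · obtain ⟨-, δ, hδ, rfl, -, htop, hbot⟩ := hO
    exact isBounded_range_of_tendsto hδ.continuous htop hbot
  · exact hO.omegaLimitSet_eq hγ hγO
  · intro t₀ ht₀ K hK hsub hK0
    have h0 : (0 : ℝ × ℝ) ∈ omegaLimitSet γ I := by
      rw [hO.omegaLimitSet_eq hγ hγO]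
      exact mem_singleton _
    exact hK0 (closure_minimal hsub hK.isClosed (mem_iInter₂.1 h0 t₀ ht₀)) rfl
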